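/- Let $AP$ be a finite set of atomic propositions and let $\mathcal A=(L,X,E,\mathcal I,\mathcal L)$ be a non-blocking timed automaton over $AP$: $L$ is a finite set of locations, $X$ a finite set of clocks, $E\subseteq L\times\mathcal G(X)\times 2^X\times L$ a finite set of edges, $\mathcal I:L\to\mathcal G(X)$ assigns invariants and $\mathcal L:L\to 2^{AP}$ labels, where a guard in $\mathcal G(X)$ is a finite conjunction of constraints $x\sim c$ with $x\in X$, $c\in\mathbb N$, $\sim\in\{<,\le,=,\ge,>\}$. A state is a pair $(\ell,v)$ with $v\in\mathbb R_+^X$ and $v\models\mathcal I(\ell)$. There is a transition $(\ell,v)\xrightarrow{\tau,e}(\ell',v')$ with $\tau\in\mathbb R_+$ and $e=(\ell,g,Y,\ell')\in E$ iff $v+\tau'\models\mathcal I(\ell)$ for all $0\le\tau'\le\tau$, $v+\tau\models g$, $v'=[Y\leftarrow 0](v+\tau)$ and $v'\models\mathcal I(\ell')$. Non-blocking means that every state has an outgoing transition. *Topology.* For a state $s$, edges $e_1,\dots,e_n$ and $\mathcal C\subseteq\mathbb R^n$, let $\pi_{\mathcal C}(s,e_1\dots e_n)$ be the set of finite runs $s\xrightarrow{\tau_1,e_1}\cdots\xrightarrow{\tau_n,e_n}s_n$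 with $(\tau_i)_i\in\mathcal C$, let $\mathrm{Pol}(\pi_{\mathcal C})\subseteq\mathbb R_+^n$ be the set of its delay vectors, and let $\mathrm{Cyl}(\pi_{\mathcal C})$ be the set of infinite runs from $s$ with a prefix in it. Let $\mathcal C_i$ be the projection of $\mathrm{Pol}(\pi_{\mathcal C})$ to the first $i$ coordinates ($\mathcal C_0$ is true). The path $\pi_{\mathcal C}$ is thin if for some $1\le i\le n$, $$\dim\mathrm{Pol}\big(\pi_{\mathcal C_i}(s,e_1\dots e_i)\big)<\dim\bigcup_{e\in E}\mathrm{Pol}\big(\pi_{\mathcal C_{i-1}}(s,e_1\dots e_{i-1}e)\big),$$ and thick otherwise (with $\dim\emptyset=-\infty$). The set $\mathrm{Runs}(\mathcal A,s)$ of infinite runs from $s$ carries the topology whose basic open sets are $\mathrm{Runs}(\mathcal A,s)$, $\emptyset$, and the cylinders $\mathrm{Cyl}(\pi_{\mathcal C})$ with $\pi_{\mathcal C}$ thick, $\mathcal C$ Borel, and $\mathrm{Pol}(\pi_{\mathcal C})$ open in the polyhedron of the unconstrained path. A property $P\subseteq(2^{AP})^\omega$ is largely satisfied from $s$ if the set of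 runs in $\mathrm{Runs}(\mathcal A,s)$ whose sequence of labels is not in $P$ is meagre. *Thick graph.* Let $M$ be the maximal constant used in $\mathcal A$. Valuations $v,v'$ are region equivalent if for every clock $x$ either $v(x),v'(x)>M$, or $\lfloor v(x)\rfloor=\lfloor v'(x)\rfloor$ and ($\{v(x)\}=0$ iff $\{v'(x)\}=0$), and if for all $x,y$ with $v(x),v(y)\le M$: $\{v(x)\}\le\{v(y)\}$ iff $\{v'(x)\}\le\{v'(y)\}$. The classes are the regions. The region automaton has vertices $(\ell,r)$, $r$ a region, and an edge $f=\big((\ell,r)\xrightarrow{r'',e}(\ell',r')\big)$ whenever $(\ell,v)\xrightarrow{\tau,e}(\ell',v')$ for some $v\in r$ and $\tau\in\mathbb R_+$ with $v+\tau\in r''$, $v'\in r'$. For $v\in r$ let $I(v,f)$ be the set of $\tau$ for which there is such a transition from $(\ell,v)$, and let $I(v)$ be the union of the sets $I(v,f)$ over all edges $f$ leaving $(\ell,r)$. The edge $f$ is thin if $\dim I(v,f)<\dim I(v)$ for some $v\in r$. The thick graph is obtained by deleting all thin edges. The label of $(\ell,r)$ is $\mathcal L(\ell)$. *Theorem.*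 Let $s=(\ell,v)$ be a state of $\mathcal A$ and let $P\subseteq(2^{AP})^\omega$ be prefix-independent, in the sense that whether a word belongs to $P$ depends only on the set of letters of $2^{AP}$ that occur in it infinitely often. Then $P$ is largely satisfied from $s$ if and only if every bottom strongly connected component $C$ of the thick graph that is reachable from $[s]=(\ell,[v])$ satisfies $P$, that is, the label sequence of every infinite path of the thick graph that visits every vertex of $C$ infinitely often is in $P$. -/

import Mathlib

open scoped NNReal ENNReal

/-- Comparison symbols of guards. -/
inductive Cmp where
  | lt | le | eq | ge | gt

/-- `c.Holds a b` : the comparison `a c b`. -/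
def Cmp.Holds : Cmp → ℝ≥0 → ℝ≥0 → Prop
  | .lt, a, b => a < b
  | .le, a, b => a ≤ b
  | .eq, a, b => a = b
  | .ge, a, b => a ≥ b
  | .gt, a, b => a > b

/-- An atomic clock constraint `x ∼ c` with `c ∈ ℕ`. -/
structure ClockAtom (X : Type*) where
  clock : X
  cmp : Cmp
  const : ℕ

/-- A guard: a finite conjunction of atomic clock constraints. -/
abbrev Guard (X : Type*) := Finset (ClockAtom X)

/-- Clock valuations `X → ℝ₊`. -/
abbrev Val (X : Type*) := X → ℝ≥0

/-- The valuation `v + τ`. -/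
def Val.delay {X : Type*} (v : Val X) (τ : ℝ≥0) : Val X := fun x => v x + τ

/-- The valuation `[Y ← 0] v`. -/
noncomputable def Val.reset {X : Type*} (Y : Set X) (v : Val X) : Val X := Yᶜ.indicator v

/-- `v ⊨ g`. -/
def Val.Sat {X : Type*} (v : Val X) (g : Guard X) : Prop :=
  ∀ a ∈ g, a.cmp.Holds (v a.clock) a.const

/-- Edges `(ℓ, g, Y, ℓ')`. -/
structure TAEdge (L X : Type*) where
  source : L
  guard : Guard X
  resets : Set X
  target : L

/-- A timed automaton with locations `L`, clocks `X` and atomic propositions `AP`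
(finiteness of these three types is assumed where needed). -/
structure TimedAutomaton (L X AP : Type*) where
  edges : Finset (TAEdge L X)
  inv : L → Guard X
  label : L → Set AP

namespace TimedAutomaton

variable {L X AP : Type*} (A : TimedAutomaton L X AP)

/-- `s = (ℓ, v)` is a state of `A`: the valuation satisfies the invariant of the location. -/
def IsState (s : L × Val X) : Prop := s.2.Sat (A.inv s.1)

/-- The transition `s --τ,e--> s'` of the timed transition system of `A`. -/
def Step (s : L × Val X) (τ : ℝ≥0) (e : TAEdge L X) (s' : L × Val X) : Prop :=
  e ∈ A.edges ∧ s.1 = e.source ∧ s'.1 = e.target ∧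
  (∀ τ' ≤ τ, (s.2.delay τ').Sat (A.inv s.1)) ∧
  (s.2.delay τ).Sat e.guard ∧
  s'.2 = (s.2.delay τ).reset e.resets ∧
  s'.2.Sat (A.inv s'.1)

/-- Every state has an outgoing transition. -/
def NonBlocking : Prop := ∀ s, A.IsState s → ∃ τ e s', A.Step s τ e s'

/-! ### Runs and symbolic paths -/

/-- Infinite runs from `s`; `edge i` and `delay i` label the `(i+1)`-st transition. -/
structure Run (s : L × Val X) where
  state : ℕ → L × Val X
  delay : ℕ → ℝ≥0
  edge : ℕ → TAEdge L X
  start : state 0 = s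
  step : ∀ i, A.Step (state i) (delay i) (edge i) (state (i + 1))

/-- The delays `τ` and edges `es` are those of a finite run from `s`. -/
def IsFiniteRun (s : L × Val X) {n : ℕ} (es : Fin n → TAEdge L X) (τ : Fin n → ℝ≥0) : Prop :=
  ∃ σ : Fin (n + 1) → L × Val X, σ 0 = s ∧
    ∀ i : Fin n, A.Step (σ i.castSucc) (τ i) (es i) (σ i.succ)

/-- The set of delay vectors (in `ℝⁿ`) of the finite runs in the symbolic path from `s` along
the edges `es`, constrained by `C`. -/
def Pol (s : L × Val X) {n : ℕ} (es : Fin n → TAEdge L X) (C : Set (Fin n → ℝ)) :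
    Set (Fin n → ℝ) :=
  {t | t ∈ C ∧ ∃ τ : Fin n → ℝ≥0, (∀ i, t i = (τ i : ℝ)) ∧ A.IsFiniteRun s es τ}

/-- The cylinder of the symbolic path from `s` along `es`, constrained by `C`: the infinite runs
having a finite prefix in that path. -/
def Cyl (s : L × Val X) {n : ℕ} (es : Fin n → TAEdge L X) (C : Set (Fin n → ℝ)) :
    Set (A.Run s) :=
  {ρ | (∀ i : Fin n, ρ.edge i = es i) ∧ (fun i : Fin n => (ρ.delay i : ℝ)) ∈ C}

end TimedAutomaton

/-- The dimension of a set of reals or of real vectors: `⊥` for the empty set and the Hausdorff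
dimension otherwise. It is applied to finite unions of relatively open subsets of convex polyhedra,
where the Hausdorff dimension is the usual (integer) dimension. -/
noncomputable def setDim {V : Type*} [EMetricSpace V] (S : Set V) : WithBot ℝ≥0∞ :=
  open scoped Classical in if S.Nonempty then ((dimH S : ℝ≥0∞) : WithBot ℝ≥0∞) else ⊥

namespace TimedAutomaton

variable {L X AP : Type*} (A : TimedAutomaton L X AP)

/-- The constraint on the first `m` delays induced by projecting the polyhedron of the constrained
path to its first `m` coordinates; it is `true` for `m = 0`. -/
def projConstraint (s : L × Val X) {n : ℕ} (es : Fin n → TAEdge L X) (C : Set (Fin n → ℝ))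
    (m : ℕ) (h : m ≤ n) : Set (Fin m → ℝ) :=
  {u | m = 0 ∨ ∃ t ∈ A.Pol s es C, ∀ j : Fin m, u j = t (Fin.castLE h j)}

/-- Thin constrained symbolic paths. The index `i : Fin n` stands for the `(i+1)`-st edge. -/
def ThinPath (s : L × Val X) {n : ℕ} (es : Fin n → TAEdge L X) (C : Set (Fin n → ℝ)) : Prop :=
  ∃ i : Fin n,
    setDim (A.Pol s (fun j : Fin (i + 1) => es (Fin.castLE i.isLt j))
      (A.projConstraint s es C (i + 1) i.isLt)) <
    setDim (⋃ e ∈ A.edges,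
      A.Pol s (Fin.snoc (α := fun _ => TAEdge L X) (fun j : Fin i => es (Fin.castLE i.isLt.le j)) e)
        {t : Fin (i + 1) → ℝ |
          (fun j : Fin i => t j.castSucc) ∈ A.projConstraint s es C i i.isLt.le})

/-- Thick constrained symbolic paths. -/
def ThickPath (s : L × Val X) {n : ℕ} (es : Fin n → TAEdge L X) (C : Set (Fin n → ℝ)) : Prop :=
  ¬ A.ThinPath s es C

/-- The basic open sets of runs from `s`: the whole space, the empty set, and the cylinders over
thick paths with a Borel constraint whose polyhedron is open in the polyhedron of the
unconstrained path. -/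
def basicOpens (s : L × Val X) : Set (Set (A.Run s)) :=
  {U | U = Set.univ ∨ U = ∅ ∨
    ∃ (n : ℕ) (es : Fin n → TAEdge L X) (C : Set (Fin n → ℝ)),
      A.ThickPath s es C ∧ MeasurableSet C ∧
      (∃ O : Set (Fin n → ℝ), IsOpen O ∧ A.Pol s es C = O ∩ A.Pol s es Set.univ) ∧
      U = A.Cyl s es C}

/-- The topology on the infinite runs from `s`. -/
instance runTopology (s : L × Val X) : TopologicalSpace (A.Run s) :=
  TopologicalSpace.generateFrom (A.basicOpens s)

/-! ### Properties over `AP` -/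

/-- The sequence of labels of a run. -/
def Run.trace {A : TimedAutomaton L X AP} {s : L × Val X} (ρ : A.Run s) : ℕ → Set AP :=
  fun i => A.label (ρ.state i).1

/-- `A` largely satisfies `P` from `s`: the runs violating `P` form a meagre set. -/
def LargelySatisfies (s : L × Val X) (P : Set (ℕ → Set AP)) : Prop :=
  IsMeagre {ρ : A.Run s | ρ.trace ∈ P}ᶜ

/-! ### Regions and the thick graph -/

/-- The maximal constant used in the guards and invariants of `A` (`0` if there is none). -/
def maxConst [Fintype L] : ℕ :=
  max (A.edges.sup fun e => e.guard.sup ClockAtom.const)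
    (Finset.univ.sup fun ℓ => (A.inv ℓ).sup ClockAtom.const)

end TimedAutomaton

/-- Region equivalence of valuations with respect to the maximal constant `M`. -/
def RegionEquiv {X : Type*} (M : ℕ) (v v' : Val X) : Prop :=
  (∀ x, ((M : ℝ≥0) < v x ∧ (M : ℝ≥0) < v' x) ∨
    (⌊(v x : ℝ)⌋ = ⌊(v' x : ℝ)⌋ ∧ (Int.fract (v x : ℝ) = 0 ↔ Int.fract (v' x : ℝ) = 0))) ∧
  (∀ x y, v x ≤ M → v y ≤ M →
    (Int.fract (v x : ℝ) ≤ Int.fract (v y : ℝ) ↔ Int.fract (v' x : ℝ) ≤ Int.fract (v' y : ℝ)))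

theorem le_natCast_iff_floor_fract (M : ℕ) (a : ℝ) :
    a ≤ M ↔ ⌊a⌋ < (M : ℤ) ∨ (⌊a⌋ = (M : ℤ) ∧ Int.fract a = 0) := by
  have hf := Int.floor_add_fract a
  constructor
  · intro h
    by_cases h1 : ⌊a⌋ < (M : ℤ)
    · exact Or.inl h1
    · right
      have h2 : (M : ℤ) ≤ ⌊a⌋ := not_lt.1 h1
      have h3 : (M : ℝ) ≤ (⌊a⌋ : ℝ) := by exact_mod_cast h2
      have h4 := Int.fract_nonneg a
      refine ⟨le_antisymm ?_ h2, by linarith⟩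
      have h5 : (⌊a⌋ : ℝ) ≤ (M : ℝ) := by linarith
      exact_mod_cast h5
  · rintro (h | ⟨h, h'⟩)
    · have h1 : a < ((M : ℤ) : ℝ) := Int.floor_lt.1 h
      exact_mod_cast h1.le
    · rw [h, h'] at hf
      push_cast at hf
      linarith

theorem RegionEquiv.le_iff {X : Type*} {M : ℕ} {v v' : Val X} (h : RegionEquiv M v v') (x : X) :
    v x ≤ M ↔ v' x ≤ M := by
  rcases h.1 x with ⟨h1, h2⟩ | ⟨h1, h2⟩
  · simp [h1.not_ge, h2.not_ge]
  · have key := le_natCast_iff_floor_fract M (v x)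
    rw [h1, h2, ← le_natCast_iff_floor_fract] at key
    exact_mod_cast key

/-- Region equivalence as an equivalence relation. -/
def regionSetoid (X : Type*) (M : ℕ) : Setoid (Val X) where
  r := RegionEquiv M
  iseqv :=
    { refl := fun v => ⟨fun _ => Or.inr ⟨rfl, Iff.rfl⟩, fun _ _ _ _ => Iff.rfl⟩
      symm := fun {v v'} h =>
        ⟨fun x => (h.1 x).imp (fun k => ⟨k.2, k.1⟩) (fun k => ⟨k.1.symm, k.2.symm⟩),
          fun x y hx hy => (h.2 x y ((h.le_iff x).2 hx) ((h.le_iff y).2 hy)).symm⟩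
      trans := fun {u v w} h k => by
        refine ⟨fun x => ?_, fun x y hx hy =>
          (h.2 x y hx hy).trans (k.2 x y ((h.le_iff x).1 hx) ((h.le_iff y).1 hy))⟩
        by_cases hx : u x ≤ M
        · have hv := (h.le_iff x).1 hx
          have h1 := (h.1 x).resolve_left fun t => t.1.not_ge hx
          have k1 := (k.1 x).resolve_left fun t => t.1.not_ge hv
          exact Or.inr ⟨h1.1.trans k1.1, h1.2.trans k1.2⟩
        · have hv := fun t => hx ((h.le_iff x).2 t)
          have hw := fun t => hv ((k.le_iff x).2 t)
          exact Or.inl ⟨not_le.1 hx, not_le.1 hw⟩ }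

namespace TimedAutomaton

variable {L X AP : Type*} [Fintype L] (A : TimedAutomaton L X AP)

/-- The regions of `A`. -/
def Region : Type _ := Quotient (regionSetoid X A.maxConst)

/-- The region `[v]` of a valuation. -/
def regionOf (v : Val X) : A.Region := Quotient.mk (regionSetoid X A.maxConst) v

/-- The delays after which, from the state `(ℓ, v)`, the edge `e` of `A` can be taken so that it
is fired in the region `r''` and leads to the location and region `q'`. -/
def edgeDelays (ℓ : L) (v : Val X) (r'' : A.Region) (e : TAEdge L X) (q' : L × A.Region) :
    Set ℝ :=
  {t | ∃ (τ : ℝ≥0) (v' : Val X), t = τ ∧ A.Step (ℓ, v) τ e (q'.1, v') ∧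
    A.regionOf (v.delay τ) = r'' ∧ A.regionOf v' = q'.2}

/-- `(ℓ, r) --(r'', e)--> (ℓ', r')` is an edge of the timed region automaton: there are `v ∈ r` and
a delay `τ` such that `(ℓ, v) --τ,e--> (ℓ', v')` with `v + τ ∈ r''` and `v' ∈ r'`. (The clocks to
be reset are recorded in `e`; the guard of the edge is membership in `r''`.) -/
def RegionEdge (q : L × A.Region) (r'' : A.Region) (e : TAEdge L X) (q' : L × A.Region) : Prop :=
  ∃ v : Val X, A.regionOf v = q.2 ∧ (A.edgeDelays q.1 v r'' e q').Nonempty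

/-- The edge `q --(r'', e)--> q'` of the region automaton is thin: from some `v` in the region of
`q`, its set of delays has smaller dimension than the set of all possible delays. -/
def ThinEdge (q : L × A.Region) (r'' : A.Region) (e : TAEdge L X) (q' : L × A.Region) : Prop :=
  ∃ v : Val X, A.regionOf v = q.2 ∧
    setDim (A.edgeDelays q.1 v r'' e q') <
      setDim (⋃ (r₁ : A.Region) (e₁ : TAEdge L X) (q₁ : L × A.Region), A.edgeDelays q.1 v r₁ e₁ q₁)

/-- The edge relation of the thick graph: the region automaton without its thin edges. -/
def ThickGraph (q q' : L × A.Region) : Prop :=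
  ∃ (r'' : A.Region) (e : TAEdge L X), A.RegionEdge q r'' e q' ∧ ¬ A.ThinEdge q r'' e q'

/-- Infinite paths of the thick graph. -/
def IsThickGraphPath (π : ℕ → L × A.Region) : Prop := ∀ i, A.ThickGraph (π i) (π (i + 1))

end TimedAutomaton

/-- Bottom strongly connected components of a directed graph: non-empty sets of pairwise mutually
reachable vertices that no edge leaves. -/
def IsBSCC {Q : Type*} (G : Q → Q → Prop) (C : Set Q) : Prop :=
  C.Nonempty ∧ (∀ q ∈ C, ∀ q' ∈ C, Relation.ReflTransGen G q q') ∧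
    ∀ q ∈ C, ∀ q', G q q' → q' ∈ C

/-- The letters occurring infinitely often in an infinite word. -/
def infLetters {B : Type*} (w : ℕ → B) : Set B := {b | ∃ᶠ i in Filter.atTop, w i = b}

/-- Prefix-independent properties: validity depends only on the set of letters that are
encountered infinitely often. -/
def PrefixIndependent {AP : Type*} (P : Set (ℕ → Set AP)) : Prop :=
  ∀ w w' : ℕ → Set AP, infLetters w = infLetters w' → (w ∈ P ↔ w' ∈ P)

namespace TimedAutomaton

variable {L X AP : Type*} [Fintype L] (A : TimedAutomaton L X AP)

/-- A set `C` of vertices of the thick graph satisfies `P`: every infinite path of the thick graph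
visiting infinitely often all vertices of `C` satisfies `P`. -/
def ComponentSatisfies (C : Set (L × A.Region)) (P : Set (ℕ → Set AP)) : Prop :=
  ∀ π : ℕ → L × A.Region, A.IsThickGraphPath π →
    (∀ q ∈ C, ∃ᶠ i in Filter.atTop, π i = q) → (fun i => A.label (π i).1) ∈ P

/-- Condition `S`: all BSCCs of the thick graph that are reachable from `[s]` satisfy `P`. -/
def ConditionS (s : L × Val X) (P : Set (ℕ → Set AP)) : Prop :=
  ∀ C : Set (L × A.Region), IsBSCC A.ThickGraph C →
    (∃ q ∈ C, Relation.ReflTransGen A.ThickGraph (s.1, A.regionOf s.2) q) →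
    A.ComponentSatisfies C P

end TimedAutomaton

/-! Regions form a finite time-abstract bisimulation, so the dimension of a step can be read off
them. Call a valuation time-open if no clock equals an integer in [0, M]. From a given state all but
countably many delays lead to time-open valuations, and if a time-open one can be fired from, so can
those after a whole interval of delays. Hence a region edge survives in the thick graph exactly when
it fires in a time-open region, or when its source has no such edge at all (`not_thinEdge_iff`).

The topology is tied to the graph by thick cylinders: balls of delay vectors, cut with the
polyhedron of an edge sequence, all of whose runs follow one path of the thick graph. Delay
polyhedra are convex, so every relative neighbourhood in them has full dimension. This makes
thickness pass to smaller neighbourhoods (`ThickSet.mono`), makes the basic opens a true basis, and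
yields two facts: every non-empty open set contains a thick cylinder
(`exists_isThickCylinder_subset`), and a thick cylinder can be prolonged along any edge of the thick
graph (`IsThickCylinder.extend`).

By these facts a player who shrinks cylinders can force any reachable vertex. So a residual set of
runs follows the thick graph and visits infinitely often every vertex that stays reachable for ever.
In a finite graph such a run ends in a bottom component and visits all of it infinitely often; the
set of labels seen infinitely often is then the label set of the component, which is all that P
depends on. If all reachable components satisfy P, these generic runs satisfy P.

Conversely, a reachable component C defines a non-empty open cylinder of runs entering C. The space
of runs is Baire (`NonBlocking.baireSpace_run`): polyhedra are locally closed, so nested small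
closed cylinders have a common run. Hence a generic run satisfying P lies in that cylinder, and it
has the same recurrent labels as any path that visits all of C infinitely often. -/

/-! ### Region equivalence through integer bounds on clocks and their differences -/

theorem fract_le_fract_iff_sub_le {a b : ℝ} :
    Int.fract a ≤ Int.fract b ↔ a - b ≤ ((⌊a⌋ - ⌊b⌋ : ℤ) : ℝ) := by
  push_cast
  simp only [Int.fract]
  constructor <;> intro h <;> linarith

/-- The fractional parts differ by less than 1, so the comparison is lexicographic: integer parts
first, fractional parts in case of a tie. -/
theorem sub_le_intCast_iff_fract {a b : ℝ} (c : ℤ) :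
    a - b ≤ c ↔ ⌊a⌋ - ⌊b⌋ < c ∨ (⌊a⌋ - ⌊b⌋ = c ∧ Int.fract a ≤ Int.fract b) := by
  have ha := Int.floor_add_fract a
  have hb := Int.floor_add_fract b
  have ha0 := Int.fract_nonneg a
  have hb0 := Int.fract_nonneg b
  have ha1 := Int.fract_lt_one a
  have hb1 := Int.fract_lt_one b
  constructor
  · intro h
    rcases lt_trichotomy (⌊a⌋ - ⌊b⌋) c with h1 | h1 | h1
    · exact Or.inl h1
    · refine Or.inr ⟨h1, fract_le_fract_iff_sub_le.2 ?_⟩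
      rwa [h1]
    · have h2 : (c : ℝ) + 1 ≤ ⌊a⌋ - ⌊b⌋ := by exact_mod_cast h1
      linarith
  · rintro (h | ⟨h, h'⟩)
    · have h2 : (⌊a⌋ : ℝ) - ⌊b⌋ + 1 ≤ c := by exact_mod_cast h
      linarith
    · have h2 : (⌊a⌋ : ℝ) - ⌊b⌋ = c := by exact_mod_cast h
      linarith

theorem natCast_le_iff_le_floor (c : ℕ) (a : ℝ) : (c : ℝ) ≤ a ↔ (c : ℤ) ≤ ⌊a⌋ := by
  rw [Int.le_floor]; norm_cast

/-- Region equivalence expressed by comparisons of clocks and clock differences with integers. -/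
theorem regionEquiv_iff {X : Type*} {M : ℕ} {v v' : Val X} :
    RegionEquiv M v v' ↔
      (∀ x (c : ℕ), c ≤ M → ((v x ≤ c ↔ v' x ≤ c) ∧ ((c : ℝ≥0) ≤ v x ↔ (c : ℝ≥0) ≤ v' x))) ∧
      ∀ x y (c : ℤ), v x ≤ M → v y ≤ M →
        ((v x : ℝ) - v y ≤ c ↔ (v' x : ℝ) - v' y ≤ c) := by
  constructor
  · intro h
    refine ⟨fun x c hc => ?_, fun x y c hx hy => ?_⟩
    · rcases h.1 x with ⟨h1, h2⟩ | ⟨h1, h2⟩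
      · have hc' : (c : ℝ≥0) ≤ M := by exact_mod_cast hc
        simp [(hc'.trans_lt h1).not_ge, (hc'.trans_lt h2).not_ge, (hc'.trans_lt h1).le,
          (hc'.trans_lt h2).le]
      · have e1 := le_natCast_iff_floor_fract c (v x)
        have e2 := natCast_le_iff_le_floor c (v x)
        rw [h1, h2, ← le_natCast_iff_floor_fract] at e1
        rw [h1, ← natCast_le_iff_le_floor] at e2
        exact ⟨by exact_mod_cast e1, by exact_mod_cast e2⟩
    · have h1 := ((h.1 x).resolve_left fun t => t.1.not_ge hx).1
      have h2 := ((h.1 y).resolve_left fun t => t.1.not_ge hy).1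
      rw [sub_le_intCast_iff_fract, sub_le_intCast_iff_fract, h1, h2, h.2 x y hx hy]
  · rintro ⟨h1, h2⟩
    have key : ∀ x, v x ≤ M → ⌊(v x : ℝ)⌋ = ⌊(v' x : ℝ)⌋ ∧
        (Int.fract (v x : ℝ) = 0 ↔ Int.fract (v' x : ℝ) = 0) := by
      intro x hx
      obtain ⟨k, hk⟩ := Int.eq_ofNat_of_zero_le (Int.floor_nonneg.2 (v x).2)
      have hk0 : (k : ℝ) ≤ v x := by
        rw [natCast_le_iff_le_floor]; exact hk.ge
      have hkM : k ≤ M := by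
        have : (k : ℝ) ≤ (M : ℝ) := hk0.trans (by exact_mod_cast hx)
        exact_mod_cast this
      have hk1 : (k : ℝ) ≤ v' x := by exact_mod_cast (h1 x k hkM).2.1 (by exact_mod_cast hk0)
      have hk' : ⌊(v' x : ℝ)⌋ = k := by
        refine le_antisymm ?_ ((natCast_le_iff_le_floor _ _).1 hk1)
        -- Otherwise k + 1 ≤ v' x ≤ M, so k + 1 is an admissible constant and the comparison with it
        -- transfers back to v x, whose floor is k.
        by_contra hlt
        push Not at hlt
        have h3 : ((k + 1 : ℕ) : ℝ) ≤ v' x := by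
          rw [natCast_le_iff_le_floor]; push_cast; omega
        have h4 : v' x ≤ M := (h1 x M le_rfl).1.1 hx
        have h5 : k + 1 ≤ M := by
          have : ((k + 1 : ℕ) : ℝ) ≤ (M : ℝ) := h3.trans (by exact_mod_cast h4)
          exact_mod_cast this
        have h6 : ((k + 1 : ℕ) : ℝ) ≤ v x := by
          exact_mod_cast (h1 x (k + 1) h5).2.2 (by exact_mod_cast h3)
        rw [natCast_le_iff_le_floor] at h6
        have hk2 : ⌊(v x : ℝ)⌋ = (k : ℤ) := hk
        push_cast at h6
        omega
      have hk2 : ⌊(v x : ℝ)⌋ = (k : ℤ) := hk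
      refine ⟨hk2.trans hk'.symm, ?_⟩
      have e : ((v x : ℝ) ≤ k ↔ (v' x : ℝ) ≤ k) := by exact_mod_cast (h1 x k hkM).1
      rw [le_natCast_iff_floor_fract, le_natCast_iff_floor_fract, hk2, hk'] at e
      simpa using e
    refine ⟨fun x => ?_, fun x y hx hy => ?_⟩
    · by_cases hx : v x ≤ M
      · exact Or.inr (key x hx)
      · exact Or.inl ⟨not_le.1 hx, not_le.1 fun t => hx ((h1 x M le_rfl).1.2 t)⟩
    · rw [fract_le_fract_iff_sub_le, fract_le_fract_iff_sub_le, h2 x y _ hx hy,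
        (key x hx).1, (key y hy).1]

namespace RegionEquiv

variable {X : Type*} {M : ℕ} {v w : Val X}

theorem refl (v : Val X) : RegionEquiv M v v := (regionSetoid X M).refl v

theorem symm (h : RegionEquiv M v w) : RegionEquiv M w v := (regionSetoid X M).symm h

theorem le_natCast_iff (h : RegionEquiv M v w) {c : ℕ} (hc : c ≤ M) (x : X) :
    v x ≤ c ↔ w x ≤ c := ((regionEquiv_iff.1 h).1 x c hc).1

theorem natCast_le_iff (h : RegionEquiv M v w) {c : ℕ} (hc : c ≤ M) (x : X) :
    (c : ℝ≥0) ≤ v x ↔ (c : ℝ≥0) ≤ w x := ((regionEquiv_iff.1 h).1 x c hc).2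

theorem sub_le_iff (h : RegionEquiv M v w) {x y : X} (hx : v x ≤ M) (hy : v y ≤ M) (c : ℤ) :
    (v x : ℝ) - v y ≤ c ↔ (w x : ℝ) - w y ≤ c := (regionEquiv_iff.1 h).2 x y c hx hy

theorem cmp_iff (h : RegionEquiv M v w) {c : ℕ} (hc : c ≤ M) (x : X) (k : Cmp) :
    k.Holds (v x) c ↔ k.Holds (w x) c := by
  have h1 := h.le_natCast_iff hc x
  have h2 := h.natCast_le_iff hc x
  cases k
  · exact lt_iff_not_ge.trans ((not_congr h2).trans lt_iff_not_ge.symm)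
  · exact h1
  · exact le_antisymm_iff.trans ((and_congr h1 h2).trans le_antisymm_iff.symm)
  · exact h2
  · exact lt_iff_not_ge.trans ((not_congr h1).trans lt_iff_not_ge.symm)

theorem sat_iff (h : RegionEquiv M v w) {g : Guard X} (hg : ∀ a ∈ g, a.const ≤ M) :
    v.Sat g ↔ w.Sat g :=
  forall₂_congr fun a ha => h.cmp_iff (hg a ha) a.clock a.cmp

/-- A reset clock has value 0, so a difference bound involving it becomes an integer bound on the
other clock, which integer part and vanishing of the fractional part decide. -/
theorem reset (h : RegionEquiv M v w) (Y : Set X) : RegionEquiv M (v.reset Y) (w.reset Y) := by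
  classical
  have key : ∀ (u : Val X) (x : X), u.reset Y x = if x ∈ Y then 0 else u x := by
    intro u x
    by_cases hx : x ∈ Y <;> simp [Val.reset, hx]
  rw [regionEquiv_iff]
  simp only [key]
  refine ⟨fun x c hc => ?_, fun x y c hx hy => ?_⟩
  · split_ifs
    · simp
    · exact ⟨h.le_natCast_iff hc x, h.natCast_le_iff hc x⟩
  · split_ifs at hx hy ⊢
    · simp
    · have hyz := Int.le_floor (z := -c) (a := (v y : ℝ))
      have hyz' := Int.le_floor (z := -c) (a := (w y : ℝ))
      have := ((h.1 y).resolve_left fun t => t.1.not_ge hy).1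
      rw [this, hyz'] at hyz
      push_cast at hyz ⊢
      constructor <;> intro h3
      · have := hyz.2 (by linarith); linarith
      · have := hyz.1 (by linarith); linarith
    · have hz : ∀ a : ℝ, a - ((0 : ℝ≥0) : ℝ) ≤ c ↔
          ⌊a⌋ < c ∨ (⌊a⌋ = c ∧ Int.fract a = 0) := by
        intro a
        rw [sub_le_intCast_iff_fract]
        simp [le_antisymm_iff (a := Int.fract a), Int.fract_nonneg]
      have := ((h.1 x).resolve_left fun t => t.1.not_ge hx)
      rw [hz, hz, this.1, this.2]
    · exact h.sub_le_iff hx hy c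

end RegionEquiv

/-! ### Time successors and time-open regions -/

/-- Finite families of reals in the same order have corresponding cuts. -/
theorem exists_same_cut {ι : Type*} [Finite ι] (a b : ι → ℝ)
    (h : ∀ i j, a i ≤ a j ↔ b i ≤ b j) (t : ℝ) :
    ∃ t' : ℝ, ∀ i, (a i ≤ t ↔ b i ≤ t') ∧ (t ≤ a i ↔ t' ≤ b i) := by
  classical
  cases nonempty_fintype ι
  by_cases hj : ∃ j, a j = t
  · obtain ⟨j, rfl⟩ := hj
    exact ⟨b j, fun i => ⟨h i j, h j i⟩⟩
  · push Not at hj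
    obtain ⟨t', h1, h2⟩ := Order.exists_between_finsets
      ((Finset.univ.filter fun i => a i < t).image b)
      ((Finset.univ.filter fun i => t < a i).image b) (by
        intro x hx y hy
        simp only [Finset.mem_image, Finset.mem_filter, Finset.mem_univ, true_and] at hx hy
        obtain ⟨i, hi, rfl⟩ := hx
        obtain ⟨j, hj, rfl⟩ := hy
        exact not_le.1 fun hc => ((h j i).2 hc).not_gt (hi.trans hj))
    simp only [Finset.mem_image, Finset.mem_filter, Finset.mem_univ, true_and,
      forall_exists_index, and_imp, forall_apply_eq_imp_iff₂] at h1 h2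
    refine ⟨t', fun i => ?_⟩
    rcases lt_or_gt_of_ne (hj i) with hi | hi
    · have := h1 i hi
      simp [hi.le, hi.not_ge, this.le, this.not_ge]
    · have := h2 i hi
      simp [hi.le, hi.not_ge, this.le, this.not_ge]

/-- Region equivalent valuations have the same time successors. -/
theorem RegionEquiv.exists_delay {X : Type*} [Finite X] {M : ℕ} {v w : Val X}
    (h : RegionEquiv M v w) (τ : ℝ≥0) :
    ∃ τ' : ℝ≥0, RegionEquiv M (v.delay τ) (w.delay τ') := by
  -- The relevant instants are the times c - v x at which a clock still at most M reaches an integer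
  -- c ≤ M. Their order depends only on the region. The extra instant 0, at `none`, forces the
  -- matching delay to be non-negative.
  let ι := Option ({x : X // v x ≤ M} × Fin (M + 1))
  let a : Val X → ι → ℝ := fun u i => i.elim 0 fun p => (p.2 : ℝ) - u p.1
  have hn : ∀ x : {x : X // v x ≤ M}, ∀ c : Fin (M + 1),
      (((c : ℕ) : ℝ) - v x ≤ 0 ↔ ((c : ℕ) : ℝ) - w x ≤ 0) ∧
      (0 ≤ ((c : ℕ) : ℝ) - v x ↔ 0 ≤ ((c : ℕ) : ℝ) - w x) := by
    intro x c
    have h1 := h.le_natCast_iff (Nat.lt_succ_iff.1 c.2) x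
    have h2 := h.natCast_le_iff (Nat.lt_succ_iff.1 c.2) x
    rw [sub_nonpos, sub_nonpos, sub_nonneg, sub_nonneg]
    exact ⟨by exact_mod_cast h2, by exact_mod_cast h1⟩
  obtain ⟨t', ht'⟩ := exists_same_cut (a v) (a w) (by
    rintro (_ | ⟨x, c⟩) (_ | ⟨y, d⟩)
    · simp [a]
    · exact (hn y d).2
    · exact (hn x c).1
    · have := h.sub_le_iff y.2 x.2 ((d : ℤ) - (c : ℤ))
      push_cast at this
      simp only [a, Option.elim]
      constructor <;> intro h3
      · have := this.1 (by linarith); linarith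
      · have := this.2 (by linarith); linarith) τ
  have ht0 : 0 ≤ t' := (ht' none).1.1 τ.2
  have hle : ∀ x : {x : X // v x ≤ M}, ∀ c : ℕ, c ≤ M →
      (((v x : ℝ) + τ ≤ c ↔ (w x : ℝ) + t' ≤ c) ∧ ((c : ℝ) ≤ v x + τ ↔ (c : ℝ) ≤ w x + t')) := by
    intro x c hc
    have := ht' (some (x, ⟨c, Nat.lt_succ_iff.2 hc⟩))
    simp only [a, Option.elim] at this
    rw [sub_le_iff_le_add', sub_le_iff_le_add', le_sub_iff_add_le', le_sub_iff_add_le'] at this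
    exact ⟨this.2, this.1⟩
  lift t' to ℝ≥0 using ht0
  refine ⟨t', regionEquiv_iff.2 ⟨fun x c hc => ?_, fun x y c hx hy => ?_⟩⟩
  · by_cases hx : v x ≤ M
    · have := hle ⟨x, hx⟩ c hc
      exact ⟨by exact_mod_cast this.1, by exact_mod_cast this.2⟩
    -- A clock already above M stays above M, so every comparison is constant.
    · have hc' : (c : ℝ≥0) ≤ M := by exact_mod_cast hc
      have h1 : (c : ℝ≥0) < v x + τ := (hc'.trans_lt (not_le.1 hx)).trans_le le_self_add
      have h2 : (c : ℝ≥0) < w x + t' :=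
        (hc'.trans_lt (not_le.1 fun t => hx ((h.le_iff x).2 t))).trans_le le_self_add
      simp [Val.delay, h1.le, h1.not_ge, h2.le, h2.not_ge]
  · have := h.sub_le_iff (le_self_add.trans hx) (le_self_add.trans hy) c
    simpa [Val.delay] using this

/-- Valuations all of whose relevant clocks are non-integral: their regions are open in time. -/
def TimeOpen {X : Type*} (M : ℕ) (w : Val X) : Prop := ∀ x, ∀ c : ℕ, c ≤ M → w x ≠ c

theorem TimeOpen.congr {X : Type*} {M : ℕ} {v w : Val X} (h : RegionEquiv M v w)
    (hv : TimeOpen M v) : TimeOpen M w := fun x c hc => by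
  have := hv x c hc
  contrapose! this
  exact le_antisymm ((h.le_natCast_iff hc x).2 this.le) ((h.natCast_le_iff hc x).2 this.ge)

theorem not_timeOpen_iff {X : Type*} {M : ℕ} {w : Val X} :
    ¬ TimeOpen M w ↔ ∃ x, ∃ c : ℕ, c ≤ M ∧ w x = c := by
  simp [TimeOpen]

open Filter Topology in
/-- A time-open region is open in time, uniformly along the region one starts from. -/
theorem TimeOpen.eventually_regionEquiv {X : Type*} [Finite X] {M : ℕ} {v : Val X} {τ : ℝ≥0}
    (h : TimeOpen M (v.delay τ)) :
    ∀ᶠ p : Val X × ℝ≥0 in 𝓝 (v, τ),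
      RegionEquiv M v p.1 → RegionEquiv M (v.delay τ) (p.1.delay p.2) := by
  have key : ∀ x : X, ∀ c : Fin (M + 1), ∀ᶠ p : Val X × ℝ≥0 in 𝓝 (v, τ),
      (v x + τ ≤ (c : ℕ) ↔ p.1 x + p.2 ≤ (c : ℕ)) ∧
      (((c : ℕ) : ℝ≥0) ≤ v x + τ ↔ ((c : ℕ) : ℝ≥0) ≤ p.1 x + p.2) := by
    intro x c
    have hcont : Continuous fun p : Val X × ℝ≥0 => p.1 x + p.2 := by fun_prop
    rcases lt_or_gt_of_ne (h x c (Nat.lt_succ_iff.1 c.2)) with hlt | hlt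
    · filter_upwards [hcont.continuousAt.eventually_lt continuousAt_const hlt] with p hp
      have hlt' : v x + τ < (c : ℕ) := hlt
      simp [hlt'.le, hlt'.not_ge, hp.le, hp.not_ge]
    · filter_upwards [continuousAt_const.eventually_lt hcont.continuousAt hlt] with p hp
      have hlt' : ((c : ℕ) : ℝ≥0) < v x + τ := hlt
      simp [hlt'.le, hlt'.not_ge, hp.le, hp.not_ge]
  filter_upwards [eventually_all.2 fun x => eventually_all.2 (key x)] with p hp hv
  refine regionEquiv_iff.2 ⟨fun x c hc => hp x ⟨c, Nat.lt_succ_iff.2 hc⟩, fun x y c hx hy => ?_⟩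
  have := hv.sub_le_iff (le_self_add.trans hx) (le_self_add.trans hy) c
  simpa [Val.delay] using this

/-! ### Regions cut out by finitely many closed conditions -/

/-- The indices of the closed conditions that determine the region of a valuation. -/
abbrev RegionAtom (X : Type*) (M : ℕ) : Type _ :=
  (X × Fin (M + 1)) ⊕ (X × Fin (M + 1)) ⊕ (X × X × Set.Icc (-M : ℤ) M)

/-- The closed conditions that determine the region of a valuation. -/
def RegionAtom.toSet {X : Type*} {M : ℕ} : RegionAtom X M → Set (Val X)
  | .inl (x, c) => {v | v x ≤ (c : ℕ)}
  | .inr (.inl (x, c)) => {v | ((c : ℕ) : ℝ≥0) ≤ v x}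
  | .inr (.inr (x, y, c)) => {v | v x ≤ M ∧ v y ≤ M ∧ (v x : ℝ) - v y ≤ ((c : ℤ) : ℝ)}

theorem RegionAtom.isClosed_toSet {X : Type*} {M : ℕ} (j : RegionAtom X M) :
    IsClosed j.toSet := by
  rcases j with ⟨x, c⟩ | ⟨x, c⟩ | ⟨x, y, c⟩
  · exact isClosed_le (continuous_apply x) continuous_const
  · exact isClosed_le continuous_const (continuous_apply x)
  · exact (isClosed_le (continuous_apply x) continuous_const).inter
      ((isClosed_le (continuous_apply y) continuous_const).inter
        (isClosed_le ((NNReal.continuous_coe.comp (continuous_apply x)).sub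
          (NNReal.continuous_coe.comp (continuous_apply y))) continuous_const))

/-- Two clocks in [0, M] differ by at most M, so difference bounds outside [-M, M] are decided in
advance. Finitely many closed conditions remain; this serves both to count regions and to make them
constant on small open sets. -/
theorem RegionAtom.regionEquiv {X : Type*} {M : ℕ} {v w : Val X}
    (h : ∀ j : RegionAtom X M, v ∈ j.toSet ↔ w ∈ j.toSet) : RegionEquiv M v w := by
  have h1 : ∀ x (c : ℕ), c ≤ M → (v x ≤ c ↔ w x ≤ c) :=
    fun x c hc => h (.inl (x, ⟨c, Nat.lt_succ_iff.2 hc⟩))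
  refine regionEquiv_iff.2 ⟨fun x c hc => ⟨h1 x c hc,
    h (.inr (.inl (x, ⟨c, Nat.lt_succ_iff.2 hc⟩)))⟩, fun x y c hx hy => ?_⟩
  have hx' := (h1 x M le_rfl).1 hx
  have hy' := (h1 y M le_rfl).1 hy
  have bd : ∀ a b : ℝ≥0, a ≤ M → b ≤ M → (a : ℝ) - b ≤ M ∧ -(M : ℝ) ≤ (a : ℝ) - b := by
    intro a b ha hb
    have ha' : (a : ℝ) ≤ M := by exact_mod_cast ha
    have hb' : (b : ℝ) ≤ M := by exact_mod_cast hb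
    have := a.2
    have := b.2
    constructor <;> simp only [NNReal.val_eq_coe] at * <;> linarith
  by_cases hc1 : c ≤ M
  · by_cases hc2 : -M ≤ c
    · have := h (.inr (.inr (x, y, ⟨c, hc2, hc1⟩)))
      simpa [RegionAtom.toSet, hx, hy, hx', hy'] using this
    · have hc3 : (c : ℝ) < -M := by
        have := not_le.1 hc2
        exact_mod_cast this
      exact iff_of_false (by have := (bd _ _ hx hy).2; linarith)
        (by have := (bd _ _ hx' hy').2; linarith)
  · have hc3 : (M : ℝ) < c := by
      have := not_le.1 hc1
      exact_mod_cast this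
    exact iff_of_true (by have := (bd _ _ hx hy).1; linarith)
        (by have := (bd _ _ hx' hy').1; linarith)

/-! ### Order-convexity and local closedness of guards -/

/-- Every comparison with a constant cuts out an interval. This is the source of the convexity of
delay polyhedra; unordered intervals are used because different clocks may be ordered differently at
the two endpoints. -/
theorem Cmp.Holds.of_mem_uIcc {k : Cmp} {a b c d : ℝ≥0} (ha : k.Holds a d) (hb : k.Holds b d)
    (hc : c ∈ Set.uIcc a b) : k.Holds c d := by
  have hs : Set.OrdConnected {a : ℝ≥0 | k.Holds a d} := by
    cases k
    · exact Set.ordConnected_Iio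
    · exact Set.ordConnected_Iic
    · exact Set.ordConnected_singleton
    · exact Set.ordConnected_Ici
    · exact Set.ordConnected_Ioi
  exact hs.uIcc_subset ha hb hc

theorem Val.Sat.of_mem_uIcc {X : Type*} {u v w : Val X} {g : Guard X} (hu : u.Sat g)
    (hv : v.Sat g) (hw : ∀ x, w x ∈ Set.uIcc (u x) (v x)) : w.Sat g :=
  fun a ha => (hu a ha).of_mem_uIcc (hv a ha) (hw _)

open scoped Classical in
theorem Val.reset_apply {X : Type*} (Y : Set X) (v : Val X) (x : X) :
    v.reset Y x = if x ∈ Y then 0 else v x := by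
  by_cases hx : x ∈ Y <;> simp [Val.reset, hx]

/-- Strict and weak comparisons occur together, so guards are neither open nor closed in general.
Local closedness survives finite conjunctions and suffices for the limit argument behind the Baire
property. -/
theorem Cmp.isLocallyClosed_setOf_holds (k : Cmp) (d : ℝ≥0) :
    IsLocallyClosed {a : ℝ≥0 | k.Holds a d} := by
  cases k
  · exact isOpen_Iio.isLocallyClosed
  · exact isClosed_Iic.isLocallyClosed
  · exact isClosed_singleton.isLocallyClosed
  · exact isClosed_Ici.isLocallyClosed
  · exact isOpen_Ioi.isLocallyClosed

theorem isLocallyClosed_univ {Z : Type*} [TopologicalSpace Z] :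
    IsLocallyClosed (Set.univ : Set Z) := isOpen_univ.isLocallyClosed

theorem IsLocallyClosed.biInter_finset {Z ι : Type*} [TopologicalSpace Z] (s : Finset ι)
    {f : ι → Set Z} (h : ∀ i ∈ s, IsLocallyClosed (f i)) : IsLocallyClosed (⋂ i ∈ s, f i) := by
  classical
  induction s using Finset.induction_on with
  | empty => simpa using isLocallyClosed_univ
  | insert a s ha ih =>
    rw [Finset.set_biInter_insert]
    exact (h a (by simp)).inter (ih fun i hi => h i (by simp [hi]))

theorem Val.isLocallyClosed_setOf_sat {X : Type*} (g : Guard X) :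
    IsLocallyClosed {v : Val X | v.Sat g} := by
  have : {v : Val X | v.Sat g} =
      ⋂ a ∈ g, (fun v : Val X => v a.clock) ⁻¹' {b : ℝ≥0 | a.cmp.Holds b a.const} := by
    ext v; simp [Val.Sat]
  rw [this]
  exact IsLocallyClosed.biInter_finset g fun a _ =>
    (a.cmp.isLocallyClosed_setOf_holds _).preimage (continuous_apply _)

theorem Val.continuous_reset {X : Type*} (Y : Set X) :
    Continuous fun v : Val X => v.reset Y := by
  classical
  refine continuous_pi fun x => ?_
  simp only [Val.reset_apply]
  split_ifs
  · exact continuous_const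
  · exact continuous_apply x

theorem Val.continuous_delay {X : Type*} :
    Continuous fun p : Val X × ℝ≥0 => p.1.delay p.2 :=
  continuous_pi fun x => ((continuous_apply x).comp continuous_fst).add continuous_snd

/-! ### Firing of edges and its invariance under region equivalence -/

namespace TimedAutomaton

variable {L X AP : Type*} (A : TimedAutomaton L X AP)

/-- The state reached from `σ` by waiting `τ` and taking the edge `e`. -/
noncomputable def next (σ : L × Val X) (τ : ℝ≥0) (e : TAEdge L X) : L × Val X :=
  (e.target, (σ.2.delay τ).reset e.resets)

/-- The edge `e` can be taken from `σ` after the delay `τ`. -/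
def Fires (σ : L × Val X) (τ : ℝ≥0) (e : TAEdge L X) : Prop := A.Step σ τ e (next σ τ e)

variable {A}

theorem step_iff {σ σ' : L × Val X} {τ : ℝ≥0} {e : TAEdge L X} :
    A.Step σ τ e σ' ↔ A.Fires σ τ e ∧ σ' = next σ τ e := by
  constructor
  · intro h
    have h' : σ' = next σ τ e := Prod.ext h.2.2.1 h.2.2.2.2.2.1
    exact ⟨by rwa [Fires, ← h'], h'⟩
  · rintro ⟨h, rfl⟩
    exact h

theorem fires_iff {σ : L × Val X} {τ : ℝ≥0} {e : TAEdge L X} :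
    A.Fires σ τ e ↔ e ∈ A.edges ∧ σ.1 = e.source ∧ σ.2.Sat (A.inv σ.1) ∧
      (σ.2.delay τ).Sat (A.inv σ.1) ∧ (σ.2.delay τ).Sat e.guard ∧
      ((σ.2.delay τ).reset e.resets).Sat (A.inv e.target) := by
  constructor
  · rintro ⟨h1, h2, -, h3, h4, -, h5⟩
    refine ⟨h1, h2, ?_, h3 τ le_rfl, h4, h5⟩
    have h0 : σ.2.delay 0 = σ.2 := funext fun x => add_zero _
    exact h0 ▸ h3 0 zero_le
  · rintro ⟨h1, h2, h3, h4, h5, h6⟩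
    refine ⟨h1, h2, rfl, fun τ' hτ' => h3.of_mem_uIcc h4 fun x => ?_, h5, rfl, h6⟩
    rw [Set.mem_uIcc]
    exact Or.inl ⟨le_self_add, by simpa [Val.delay] using hτ'⟩

theorem Fires.isState_next {σ : L × Val X} {τ : ℝ≥0} {e : TAEdge L X} (h : A.Fires σ τ e) :
    A.IsState (next σ τ e) := (fires_iff.1 h).2.2.2.2.2

theorem Fires.of_mem_uIcc {ℓ : L} {u v w : Val X} {τ₁ τ₂ τ : ℝ≥0} {e : TAEdge L X}
    (h₁ : A.Fires (ℓ, u) τ₁ e) (h₂ : A.Fires (ℓ, v) τ₂ e) (hw : ∀ x, w x ∈ Set.uIcc (u x) (v x))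
    (hd : ∀ x, w x + τ ∈ Set.uIcc (u x + τ₁) (v x + τ₂)) : A.Fires (ℓ, w) τ e := by
  classical
  rw [fires_iff] at h₁ h₂ ⊢
  refine ⟨h₁.1, h₁.2.1, h₁.2.2.1.of_mem_uIcc h₂.2.2.1 hw, h₁.2.2.2.1.of_mem_uIcc h₂.2.2.2.1 hd,
    h₁.2.2.2.2.1.of_mem_uIcc h₂.2.2.2.2.1 hd,
    h₁.2.2.2.2.2.of_mem_uIcc h₂.2.2.2.2.2 fun x => ?_⟩
  simp only [Val.reset_apply]
  split_ifs
  · simp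
  · exact hd x

theorem isLocallyClosed_setOf_fires (ℓ : L) (e : TAEdge L X) :
    IsLocallyClosed {p : Val X × ℝ≥0 | A.Fires (ℓ, p.1) p.2 e} := by
  by_cases h : e ∈ A.edges ∧ ℓ = e.source
  · have : {p : Val X × ℝ≥0 | A.Fires (ℓ, p.1) p.2 e} =
        (((fun p : Val X × ℝ≥0 => p.1) ⁻¹' {v | v.Sat (A.inv ℓ)}) ∩
        (fun p : Val X × ℝ≥0 => p.1.delay p.2) ⁻¹' {v | v.Sat (A.inv ℓ)}) ∩
        ((fun p : Val X × ℝ≥0 => p.1.delay p.2) ⁻¹' {v | v.Sat e.guard} ∩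
        (fun p : Val X × ℝ≥0 => (p.1.delay p.2).reset e.resets) ⁻¹'
          {v | v.Sat (A.inv e.target)}) := by
      ext p
      simp only [Set.mem_ofPred_eq, fires_iff, h.1, h.2, true_and, Set.mem_inter_iff,
        Set.mem_preimage, and_assoc]
    rw [this]
    exact (((Val.isLocallyClosed_setOf_sat _).preimage continuous_fst).inter
      ((Val.isLocallyClosed_setOf_sat _).preimage Val.continuous_delay)).inter
      (((Val.isLocallyClosed_setOf_sat _).preimage Val.continuous_delay).inter
      ((Val.isLocallyClosed_setOf_sat _).preimage
        ((Val.continuous_reset _).comp Val.continuous_delay)))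
  · have : {p : Val X × ℝ≥0 | A.Fires (ℓ, p.1) p.2 e} = ∅ := by
      ext p
      simp only [Set.mem_ofPred_eq, fires_iff, Set.mem_empty_iff_false, iff_false]
      exact fun hp => h ⟨hp.1, hp.2.1⟩
    rw [this]
    exact isOpen_empty.isLocallyClosed

variable [Fintype L]

theorem const_le_maxConst_of_mem_guard {e : TAEdge L X} (he : e ∈ A.edges) {a : ClockAtom X}
    (ha : a ∈ e.guard) : a.const ≤ A.maxConst :=
  ((Finset.le_sup (f := ClockAtom.const) ha).trans
    (Finset.le_sup (f := fun e : TAEdge L X => e.guard.sup ClockAtom.const) he)).trans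
    (le_max_left _ _)

theorem const_le_maxConst_of_mem_inv {ℓ : L} {a : ClockAtom X} (ha : a ∈ A.inv ℓ) :
    a.const ≤ A.maxConst :=
  ((Finset.le_sup (f := ClockAtom.const) ha).trans
    (Finset.le_sup (f := fun ℓ => (A.inv ℓ).sup ClockAtom.const) (Finset.mem_univ ℓ))).trans
    (le_max_right _ _)

theorem Fires.congr {ℓ : L} {v w : Val X} {τ τ' : ℝ≥0} {e : TAEdge L X}
    (h : A.Fires (ℓ, v) τ e) (h₁ : RegionEquiv A.maxConst v w)
    (h₂ : RegionEquiv A.maxConst (v.delay τ) (w.delay τ')) : A.Fires (ℓ, w) τ' e := by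
  rw [fires_iff] at h ⊢
  refine ⟨h.1, h.2.1, ?_, ?_, ?_, ?_⟩
  · exact (h₁.sat_iff fun a => const_le_maxConst_of_mem_inv).1 h.2.2.1
  · exact (h₂.sat_iff fun a => const_le_maxConst_of_mem_inv).1 h.2.2.2.1
  · exact (h₂.sat_iff fun a => const_le_maxConst_of_mem_guard h.1).1 h.2.2.2.2.1
  · exact ((h₂.reset _).sat_iff fun a => const_le_maxConst_of_mem_inv).1 h.2.2.2.2.2

theorem regionOf_eq_iff {v w : Val X} :
    A.regionOf v = A.regionOf w ↔ RegionEquiv A.maxConst v w :=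
  Quotient.eq (r := regionSetoid X A.maxConst)

/-- A region is determined by the set of atoms that hold at a representative. -/
instance [Finite X] : Finite A.Region := by
  refine Finite.of_injective
    (fun r : A.Region => {j : RegionAtom X A.maxConst | Quotient.out r ∈ j.toSet}) ?_
  intro r r' h
  rw [← Quotient.out_eq r, ← Quotient.out_eq r']
  exact Quotient.sound (RegionAtom.regionEquiv fun j => Set.ext_iff.1 h j)

variable (A) in
/-- The vertex of the region automaton to which a state belongs. -/
def reg (σ : L × Val X) : L × A.Region := (σ.1, A.regionOf σ.2)

theorem reg_eq_iff {σ σ' : L × Val X} :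
    A.reg σ = A.reg σ' ↔ σ.1 = σ'.1 ∧ RegionEquiv A.maxConst σ.2 σ'.2 := by
  rw [reg, reg, Prod.mk.injEq, regionOf_eq_iff]

/-! ### Steps of maximal dimension and thick edges -/

variable (A) in
/-- From `σ` some edge can be taken in a time-open region. -/
def HasOpen (σ : L × Val X) : Prop :=
  ∃ τ e, A.Fires σ τ e ∧ TimeOpen A.maxConst (σ.2.delay τ)

variable (A) in
/-- The transition from `σ` with delay `τ` and edge `e` is one of those of maximal dimension. -/
def ThickStep (σ : L × Val X) (τ : ℝ≥0) (e : TAEdge L X) : Prop :=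
  A.Fires σ τ e ∧ (TimeOpen A.maxConst (σ.2.delay τ) ∨ ¬ A.HasOpen σ)

/-- Time-abstract bisimulation. -/
theorem Fires.exists_of_reg_eq [Finite X] {σ σ' : L × Val X} {τ : ℝ≥0} {e : TAEdge L X}
    (h : A.Fires σ τ e) (hσ : A.reg σ = A.reg σ') :
    ∃ τ', A.Fires σ' τ' e ∧ RegionEquiv A.maxConst (σ.2.delay τ) (σ'.2.delay τ') ∧
      A.reg (next σ τ e) = A.reg (next σ' τ' e) := by
  obtain ⟨ℓ, v⟩ := σ
  obtain ⟨ℓ', w⟩ := σ'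
  rw [reg_eq_iff] at hσ
  obtain ⟨rfl, hvw⟩ := hσ
  obtain ⟨τ', hτ'⟩ := hvw.exists_delay τ
  exact ⟨τ', h.congr hvw hτ', hτ', reg_eq_iff.2 ⟨rfl, hτ'.reset _⟩⟩

theorem HasOpen.of_reg_eq [Finite X] {σ σ' : L × Val X} (h : A.HasOpen σ)
    (hσ : A.reg σ = A.reg σ') : A.HasOpen σ' := by
  obtain ⟨τ, e, h1, h2⟩ := h
  obtain ⟨τ', h3, h4, -⟩ := h1.exists_of_reg_eq hσ
  exact ⟨τ', e, h3, h2.congr h4⟩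

theorem hasOpen_congr [Finite X] {σ σ' : L × Val X} (hσ : A.reg σ = A.reg σ') :
    A.HasOpen σ ↔ A.HasOpen σ' := ⟨fun h => h.of_reg_eq hσ, fun h => h.of_reg_eq hσ.symm⟩

theorem ThickStep.exists_of_reg_eq [Finite X] {σ σ' : L × Val X} {τ : ℝ≥0} {e : TAEdge L X}
    (h : A.ThickStep σ τ e) (hσ : A.reg σ = A.reg σ') :
    ∃ τ', A.ThickStep σ' τ' e ∧ A.reg (next σ τ e) = A.reg (next σ' τ' e) := by
  obtain ⟨τ', h1, h2, h3⟩ := h.1.exists_of_reg_eq hσ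
  exact ⟨τ', ⟨h1, h.2.imp (fun t => t.congr h2) fun t => by rwa [← hasOpen_congr hσ]⟩, h3⟩

theorem NonBlocking.exists_thickStep (hA : A.NonBlocking) {σ : L × Val X} (hσ : A.IsState σ) :
    ∃ τ e, A.ThickStep σ τ e := by
  by_cases h : A.HasOpen σ
  · obtain ⟨τ, e, h1, h2⟩ := h
    exact ⟨τ, e, h1, Or.inl h2⟩
  · obtain ⟨τ, e, σ', hs⟩ := hA σ hσ
    exact ⟨τ, e, (step_iff.1 hs).1, Or.inr h⟩

/-- For each clock and each integer at most one delay brings the clock to that value. -/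
theorem countable_setOf_not_timeOpen [Finite X] (M : ℕ) (v : Val X) :
    {τ : ℝ≥0 | ¬ TimeOpen M (v.delay τ)}.Countable := by
  have : Countable X := Finite.to_countable
  refine (Set.countable_iUnion fun x : X => Set.countable_iUnion fun c : ℕ =>
    Set.countable_singleton ((c : ℝ≥0) - v x)).mono ?_
  intro τ hτ
  obtain ⟨x, c, -, h⟩ := not_timeOpen_iff.1 hτ
  refine Set.mem_iUnion.2 ⟨x, Set.mem_iUnion.2 ⟨c, ?_⟩⟩
  rw [Set.mem_singleton_iff, ← h]
  exact (add_tsub_cancel_left _ _).symm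

theorem edgeDelays_eq (ℓ : L) (v : Val X) (r'' : A.Region) (e : TAEdge L X) (q' : L × A.Region) :
    A.edgeDelays ℓ v r'' e q' = (fun τ : ℝ≥0 => (τ : ℝ)) '' {τ : ℝ≥0 | A.Fires (ℓ, v) τ e ∧
      A.regionOf (v.delay τ) = r'' ∧ A.reg (next (ℓ, v) τ e) = q'} := by
  ext t
  constructor
  · rintro ⟨τ, v', rfl, h1, h2, h3⟩
    obtain ⟨h4, h5⟩ := step_iff.1 h1
    exact ⟨τ, ⟨h4, h2, by rw [← h5, reg, h3]⟩, rfl⟩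
  · rintro ⟨τ, ⟨h1, h2, h3⟩, rfl⟩
    refine ⟨τ, (next (ℓ, v) τ e).2, rfl, ?_, h2, by rw [← h3]; rfl⟩
    rw [step_iff, ← h3]
    exact ⟨h1, rfl⟩

theorem iUnion_edgeDelays (ℓ : L) (v : Val X) :
    (⋃ (r₁ : A.Region) (e₁ : TAEdge L X) (q₁ : L × A.Region), A.edgeDelays ℓ v r₁ e₁ q₁) =
      (fun τ : ℝ≥0 => (τ : ℝ)) '' {τ : ℝ≥0 | ∃ e, A.Fires (ℓ, v) τ e} := by
  ext t
  simp only [Set.mem_iUnion, edgeDelays_eq]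
  constructor
  · rintro ⟨r, e, q, τ, h, rfl⟩
    exact ⟨τ, ⟨e, h.1⟩, rfl⟩
  · rintro ⟨τ, ⟨e, h⟩, rfl⟩
    exact ⟨_, e, _, τ, ⟨h, rfl, rfl⟩, rfl⟩

theorem Fires.edgeDelays_nonempty {ℓ : L} {v : Val X} {τ : ℝ≥0} {e : TAEdge L X}
    (h : A.Fires (ℓ, v) τ e) :
    (A.edgeDelays ℓ v (A.regionOf (v.delay τ)) e (A.reg (next (ℓ, v) τ e))).Nonempty := by
  rw [edgeDelays_eq]
  exact ⟨_, τ, ⟨h, rfl, rfl⟩, rfl⟩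

theorem Fires.iUnion_edgeDelays_nonempty {ℓ : L} {v : Val X} {τ : ℝ≥0} {e : TAEdge L X}
    (h : A.Fires (ℓ, v) τ e) :
    (⋃ (r₁ : A.Region) (e₁ : TAEdge L X) (q₁ : L × A.Region),
      A.edgeDelays ℓ v r₁ e₁ q₁).Nonempty := by
  rw [iUnion_edgeDelays]
  exact ⟨_, τ, ⟨e, h⟩, rfl⟩

theorem dimH_coe_image_eq_zero [Finite X] {M : ℕ} {v : Val X} {S : Set ℝ≥0}
    (h : ∀ τ ∈ S, ¬ TimeOpen M (v.delay τ)) : dimH ((fun τ : ℝ≥0 => (τ : ℝ)) '' S) = 0 :=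
  dimH_countable (((countable_setOf_not_timeOpen M v).mono h).image _)

theorem dimH_real_le_one (S : Set ℝ) : dimH S ≤ 1 := by
  rw [← Real.dimH_univ]; exact dimH_mono (Set.subset_univ _)

theorem setDim_of_nonempty {V : Type*} [EMetricSpace V] {S : Set V} (h : S.Nonempty) :
    setDim S = ((dimH S : ℝ≥0∞) : WithBot ℝ≥0∞) := by
  rw [setDim, if_pos h]

open Filter Topology in
theorem _root_.TimeOpen.exists_pos_regionEquiv [Finite X] {M : ℕ} {v : Val X} {τ : ℝ≥0}
    (h : TimeOpen M (v.delay τ)) :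
    ∃ δ : ℝ, 0 < δ ∧ ∀ t : ℝ≥0, |(t : ℝ) - τ| < δ → RegionEquiv M (v.delay τ) (v.delay t) := by
  have h1 : Tendsto (fun t : ℝ≥0 => (v, t)) (𝓝 τ) (𝓝 (v, τ)) :=
    (Continuous.prodMk_right v).tendsto τ
  obtain ⟨δ, hδ, hb⟩ := Metric.eventually_nhds_iff.1 (h1.eventually h.eventually_regionEquiv)
  exact ⟨δ, hδ, fun t ht => hb (by rwa [NNReal.dist_eq]) (RegionEquiv.refl v)⟩

theorem one_le_dimH_of_timeOpen [Finite X] {ℓ : L} {v : Val X} {τ : ℝ≥0} {e : TAEdge L X}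
    (h : A.Fires (ℓ, v) τ e) (ho : TimeOpen A.maxConst (v.delay τ)) :
    1 ≤ dimH ((fun τ : ℝ≥0 => (τ : ℝ)) '' {t : ℝ≥0 | A.Fires (ℓ, v) t e ∧
      A.regionOf (v.delay t) = A.regionOf (v.delay τ) ∧
        A.reg (next (ℓ, v) t e) = A.reg (next (ℓ, v) τ e)}) := by
  obtain ⟨δ, hδ, hb⟩ := ho.exists_pos_regionEquiv
  -- The interval to the right of τ is taken so that its points remain non-negative.
  have h1 : dimH (Set.Ioo (τ : ℝ) (τ + δ)) = 1 := by
    rw [Real.dimH_of_nonempty_interior]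
    · simp
    · rw [interior_Ioo]; exact Set.nonempty_Ioo.2 (by linarith)
  rw [← h1]
  refine dimH_mono fun t ht => ?_
  have ht0 : 0 ≤ t := τ.2.trans ht.1.le
  lift t to ℝ≥0 using ht0
  have := hb t (by rw [abs_lt]; constructor <;> linarith [ht.1, ht.2])
  exact ⟨t, ⟨h.congr (RegionEquiv.refl v) this, regionOf_eq_iff.2 this.symm,
    reg_eq_iff.2 ⟨rfl, (this.reset _).symm⟩⟩, rfl⟩

/-- Sets of delays from one state have dimension 1 if they contain a time-open firing and 0
otherwise. Thinness asks only for some valuation of the region; bisimulation makes the answer the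
same for all of them. -/
theorem not_thinEdge_iff [Finite X] {ℓ : L} {v : Val X} {τ : ℝ≥0} {e : TAEdge L X}
    (h : A.Fires (ℓ, v) τ e) :
    ¬ A.ThinEdge (A.reg (ℓ, v)) (A.regionOf (v.delay τ)) e (A.reg (next (ℓ, v) τ e)) ↔
      (TimeOpen A.maxConst (v.delay τ) ∨ ¬ A.HasOpen (ℓ, v)) := by
  constructor
  · intro hn
    by_contra! hc
    refine hn ⟨v, rfl, ?_⟩
    change setDim (A.edgeDelays ℓ v _ _ _) <
      setDim (⋃ (r₁ : A.Region) (e₁ : TAEdge L X) (q₁ : L × A.Region), A.edgeDelays ℓ v r₁ e₁ q₁)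
    rw [setDim_of_nonempty h.edgeDelays_nonempty, setDim_of_nonempty h.iUnion_edgeDelays_nonempty,
      iUnion_edgeDelays, edgeDelays_eq, dimH_coe_image_eq_zero (M := A.maxConst) (v := v)
      fun t ht ho => hc.1 (ho.congr (regionOf_eq_iff.1 ht.2.1))]
    obtain ⟨τ₁, e₁, h₁, h₂⟩ := hc.2
    refine WithBot.coe_lt_coe.2 (zero_lt_one.trans_le ((one_le_dimH_of_timeOpen h₁ h₂).trans ?_))
    exact dimH_mono (Set.image_mono fun t ht => ⟨_, ht.1⟩)
  · rintro hth ⟨w, hw, hlt⟩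
    have hw' : A.reg (ℓ, v) = A.reg (ℓ, w) := Prod.ext rfl hw.symm
    obtain ⟨τ', h1, h2, h3⟩ := h.exists_of_reg_eq hw'
    change setDim (A.edgeDelays ℓ w _ _ _) <
      setDim (⋃ (r₁ : A.Region) (e₁ : TAEdge L X) (q₁ : L × A.Region), A.edgeDelays ℓ w r₁ e₁ q₁)
      at hlt
    rw [h3, regionOf_eq_iff.2 h2, setDim_of_nonempty h1.edgeDelays_nonempty,
      setDim_of_nonempty h1.iUnion_edgeDelays_nonempty, iUnion_edgeDelays, edgeDelays_eq,
      WithBot.coe_lt_coe] at hlt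
    rcases hth with ho | ho
    · exact hlt.not_ge ((dimH_real_le_one _).trans (one_le_dimH_of_timeOpen h1 (ho.congr h2)))
    · rw [hasOpen_congr hw'] at ho
      rw [dimH_coe_image_eq_zero (M := A.maxConst) (v := w)
        (S := {τ | ∃ e, A.Fires (ℓ, w) τ e})] at hlt
      · exact not_lt_zero hlt
      · rintro t ⟨e', he'⟩ hto
        exact ho ⟨t, e', he', hto⟩

theorem ThickStep.thickGraph [Finite X] {σ : L × Val X} {τ : ℝ≥0} {e : TAEdge L X}
    (h : A.ThickStep σ τ e) : A.ThickGraph (A.reg σ) (A.reg (next σ τ e)) := by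
  refine ⟨A.regionOf (σ.2.delay τ), e, ⟨σ.2, rfl, ?_⟩, (not_thinEdge_iff h.1).2 h.2⟩
  rw [edgeDelays_eq]
  exact ⟨_, τ, ⟨h.1, rfl, rfl⟩, rfl⟩

/-- The edge is witnessed at one valuation of the region; bisimulation moves the witness to the
given state. -/
theorem exists_thickStep_of_thickGraph [Finite X] {σ : L × Val X} {q : L × A.Region}
    (h : A.ThickGraph (A.reg σ) q) : ∃ τ e, A.ThickStep σ τ e ∧ A.reg (next σ τ e) = q := by
  obtain ⟨r, e, ⟨v, hv, t, ht⟩, hthin⟩ := h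
  rw [edgeDelays_eq] at ht
  obtain ⟨τ, ⟨h1, rfl, rfl⟩, rfl⟩ := ht
  have hσ : A.reg (σ.1, v) = A.reg σ := Prod.ext rfl hv
  rw [← hσ] at hthin
  have h2 : A.ThickStep (σ.1, v) τ e := ⟨h1, (not_thinEdge_iff h1).1 hthin⟩
  obtain ⟨τ', h3, h4⟩ := h2.exists_of_reg_eq hσ
  exact ⟨τ', e, h3, h4.symm⟩

/-- If nothing fires in a time-open region, then each edge fires in at most one region. -/
theorem Fires.eq_of_not_hasOpen [Finite X] {σ : L × Val X} {τ τ' : ℝ≥0} {e : TAEdge L X}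
    (h : A.Fires σ τ e) (h' : A.Fires σ τ' e) (ho : ¬ A.HasOpen σ) : τ = τ' := by
  wlog hlt : τ < τ' generalizing τ τ'
  · rcases lt_trichotomy τ τ' with h1 | h1 | h1
    · exact this h h' h1
    · exact h1
    · exact (this h' h h1).symm
  -- Between two distinct firing delays the edge fires throughout, by convexity, and such an
  -- uncountable interval contains a time-open delay.
  have hu : ¬ (Set.Ioo τ τ').Countable := by
    intro hc
    obtain ⟨x, hx, hx'⟩ := ((hc.image ((↑) : ℝ≥0 → ℝ)).dense_compl ℝ).inter_open_nonempty _ isOpen_Ioo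
      (Set.nonempty_Ioo.2 (NNReal.coe_lt_coe.2 hlt))
    lift x to ℝ≥0 using τ.2.trans hx.1.le
    exact hx' ⟨x, by exact_mod_cast hx, rfl⟩
  exfalso
  refine hu ((countable_setOf_not_timeOpen A.maxConst σ.2).mono fun t ht hto => ho ⟨t, e, ?_, hto⟩)
  exact Fires.of_mem_uIcc (ℓ := σ.1) h h' (fun x => by simp) fun x => by
    rw [Set.mem_uIcc]
    exact Or.inl ⟨by gcongr; exact ht.1.le, by gcongr; exact ht.2.le⟩

end TimedAutomaton

/-! ### Delay vectors and their prefixes -/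

/-- Extension of a vector to a sequence by zero. -/
def extZero {n : ℕ} (u : Fin n → ℝ) : ℕ → ℝ := fun i => if h : i < n then u ⟨i, h⟩ else 0

theorem extZero_of_lt {n : ℕ} (u : Fin n → ℝ) {i : ℕ} (h : i < n) : extZero u i = u ⟨i, h⟩ :=
  dif_pos h

@[simp] theorem extZero_val {n : ℕ} (u : Fin n → ℝ) (i : Fin n) : extZero u i = u i :=
  extZero_of_lt u i.2

/-- The linear map taking the first `m` coordinates of a vector (padding it with zeros). -/
def restr {n : ℕ} (m : ℕ) : (Fin n → ℝ) →ₗ[ℝ] (Fin m → ℝ) where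
  toFun u := fun j => extZero u j
  map_add' u v := by ext j; simp only [extZero, Pi.add_apply]; split_ifs <;> simp
  map_smul' c u := by ext j; simp [extZero]

/-- The first `n` terms of a sequence. -/
def initSeg (n : ℕ) (t : ℕ → ℝ) : Fin n → ℝ := fun j => t j

theorem restr_apply {n m : ℕ} (u : Fin n → ℝ) (j : Fin m) : restr m u j = extZero u j := rfl

theorem extZero_restr {n m : ℕ} (u : Fin n → ℝ) {i : ℕ} (h : i < m) :
    extZero (restr m u) i = extZero u i := by rw [extZero_of_lt _ h, restr_apply]

theorem extZero_initSeg {n : ℕ} (t : ℕ → ℝ) {i : ℕ} (h : i < n) :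
    extZero (initSeg n t) i = t i := extZero_of_lt _ h

@[simp] theorem restr_self {n : ℕ} (u : Fin n → ℝ) : restr n u = u := by
  ext j; simp [restr_apply]

theorem restr_restr {n m k : ℕ} (u : Fin n → ℝ) (h : k ≤ m) : restr k (restr m u) = restr k u := by
  ext j; exact extZero_restr u (j.2.trans_le h)

theorem restr_initSeg {n m : ℕ} (t : ℕ → ℝ) (h : m ≤ n) :
    restr m (initSeg n t) = initSeg m t := by
  ext j; exact extZero_initSeg t (j.2.trans_le h)

theorem continuous_extZero {n : ℕ} : Continuous (extZero : (Fin n → ℝ) → ℕ → ℝ) := by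
  refine continuous_pi fun i => ?_
  unfold extZero
  split_ifs with h
  · exact continuous_apply _
  · exact continuous_const

theorem extZero_nonneg {n : ℕ} {u : Fin n → ℝ} (h : ∀ i < n, 0 ≤ extZero u i) (i : ℕ) :
    0 ≤ extZero u i := by
  by_cases hi : i < n
  · exact h i hi
  · simp [extZero, hi]

theorem convexCombination_mem_uIcc {p q r : ℝ≥0} {a b : ℝ} (ha : 0 ≤ a) (hb : 0 ≤ b)
    (hab : a + b = 1) (hr : (r : ℝ) = a * p + b * q) : r ∈ Set.uIcc p q := by
  rw [Set.mem_uIcc]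
  obtain rfl : b = 1 - a := by linarith
  rcases le_total p q with h | h
  · left
    have h' : (p : ℝ) ≤ q := by exact_mod_cast h
    constructor <;> rw [← NNReal.coe_le_coe, hr] <;> nlinarith
  · right
    have h' : (q : ℝ) ≤ p := by exact_mod_cast h
    constructor <;> rw [← NNReal.coe_le_coe, hr] <;> nlinarith

/-! ### Delay polyhedra and thickness of sets of delays -/

namespace TimedAutomaton

variable {L X AP : Type*}

/-- The states met from `s` when taking the edges `E` after the delays `t`. -/
noncomputable def stateAlong (s : L × Val X) (E : ℕ → TAEdge L X) (t : ℕ → ℝ) : ℕ → L × Val X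
  | 0 => s
  | i + 1 => next (stateAlong s E t i) (t i).toNNReal (E i)

theorem stateAlong_congr {s : L × Val X} {E E' : ℕ → TAEdge L X} {t t' : ℕ → ℝ} {n : ℕ}
    (hE : ∀ j < n, E j = E' j) (ht : ∀ j < n, t j = t' j) :
    stateAlong s E t n = stateAlong s E' t' n := by
  induction n with
  | zero => rfl
  | succ n ih =>
    rw [stateAlong, stateAlong, ih (fun j hj => hE j (by omega)) (fun j hj => ht j (by omega)),
      hE n (by omega), ht n (by omega)]

theorem stateAlong_extZero_restr {s : L × Val X} {E : ℕ → TAEdge L X} {n m i : ℕ}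
    (u : Fin n → ℝ) (h : i ≤ m) :
    stateAlong s E (extZero (restr m u)) i = stateAlong s E (extZero u) i :=
  stateAlong_congr (fun _ _ => rfl) fun _ hj => extZero_restr u (hj.trans_le h)

theorem stateAlong_fst (s : L × Val X) (E : ℕ → TAEdge L X) (t t' : ℕ → ℝ) (n : ℕ) :
    (stateAlong s E t n).1 = (stateAlong s E t' n).1 := by cases n <;> rfl

theorem continuous_stateAlong_snd (s : L × Val X) (E : ℕ → TAEdge L X) (n : ℕ) :
    Continuous fun t : ℕ → ℝ => (stateAlong s E t n).2 := by
  induction n with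
  | zero => exact (continuous_const : Continuous fun _ : ℕ → ℝ => s.2)
  | succ n ih =>
    have h : Continuous fun t : ℕ → ℝ => ((stateAlong s E t n).2, (t n).toNNReal) :=
      ih.prodMk (continuous_real_toNNReal.comp (continuous_apply n))
    exact (Val.continuous_reset (E n).resets).comp (Val.continuous_delay.comp h)

/-- Along fixed edges the resets are fixed, so a clock is the sum of the delays since its last
reset, plus its initial value if it was never reset: an affine function of non-negative delays. -/
theorem stateAlong_convexCombination (s : L × Val X) (E : ℕ → TAEdge L X) {t t' : ℕ → ℝ}
    (ht : ∀ i, 0 ≤ t i) (ht' : ∀ i, 0 ≤ t' i) {a b : ℝ} (ha : 0 ≤ a) (hb : 0 ≤ b)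
    (hab : a + b = 1) (n : ℕ) (x : X) :
    ((stateAlong s E (a • t + b • t') n).2 x : ℝ) =
      a * (stateAlong s E t n).2 x + b * (stateAlong s E t' n).2 x := by
  classical
  induction n with
  | zero =>
    simp only [stateAlong]
    rw [← add_mul, hab, one_mul]
  | succ n ih =>
    simp only [stateAlong, next, Val.reset_apply, Val.delay]
    split_ifs
    · simp
    · push_cast
      rw [ih, Real.coe_toNNReal _ (ht n), Real.coe_toNNReal _ (ht' n), Real.coe_toNNReal]
      · simp; ring
      · have := mul_nonneg ha (ht n)
        have := mul_nonneg hb (ht' n)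
        simp; linarith

/-- Clocks are finite sums of truncated delays max(t, 0), each of which is 1-Lipschitz. -/
theorem exists_lipschitzWith_stateAlong (s : L × Val X) (E : ℕ → TAEdge L X) (n i : ℕ) (x : X) :
    ∃ K, LipschitzWith K fun u : Fin n → ℝ => ((stateAlong s E (extZero u) i).2 x : ℝ) := by
  classical
  induction i with
  | zero => exact ⟨0, LipschitzWith.const (s.2 x : ℝ)⟩
  | succ i ih =>
    simp only [stateAlong, next, Val.reset_apply, Val.delay]
    split_ifs
    · exact ⟨0, LipschitzWith.const _⟩
    · obtain ⟨K, hK⟩ := ih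
      have : LipschitzWith 1 fun u : Fin n → ℝ => extZero u i := by
        unfold extZero
        split_ifs with h
        · exact LipschitzWith.eval _
        · exact (LipschitzWith.const _).weaken zero_le_one
      exact ⟨K + 1, by simpa [Real.coe_toNNReal'] using hK.add (this.max_const 0)⟩

variable (A : TimedAutomaton L X AP)

/-- The first `n` transitions along the edges `E` with delays `t` can be taken from `s`. -/
def FiresAlong (s : L × Val X) (E : ℕ → TAEdge L X) (t : ℕ → ℝ) (n : ℕ) : Prop :=
  ∀ i < n, 0 ≤ t i ∧ A.Fires (stateAlong s E t i) (t i).toNNReal (E i)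

variable {A}

theorem FiresAlong.congr {s : L × Val X} {E E' : ℕ → TAEdge L X} {t t' : ℕ → ℝ} {n m : ℕ}
    (h : A.FiresAlong s E t n) (hm : m ≤ n)
    (hE : ∀ j < m, E j = E' j) (ht : ∀ j < m, t j = t' j) : A.FiresAlong s E' t' m := by
  intro i hi
  rw [← ht i hi, ← hE i hi, ← stateAlong_congr (fun j hj => hE j (hj.trans hi))
    fun j hj => ht j (hj.trans hi)]
  exact h i (hi.trans_le hm)

theorem FiresAlong.isState {s : L × Val X} (hs : A.IsState s) {E : ℕ → TAEdge L X} {t : ℕ → ℝ}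
    {n i : ℕ} (h : A.FiresAlong s E t n) (hi : i ≤ n) : A.IsState (stateAlong s E t i) := by
  cases i with
  | zero => exact hs
  | succ i => exact (h i hi).2.isState_next

variable (A) in
/-- The polyhedron of the delays of the finite runs from `s` along the first `n` edges of `E`. -/
def delayPoly (s : L × Val X) (E : ℕ → TAEdge L X) (n : ℕ) : Set (Fin n → ℝ) :=
  {u | A.FiresAlong s E (extZero u) n}

theorem mem_delayPoly_initSeg {s : L × Val X} {E : ℕ → TAEdge L X} {t : ℕ → ℝ} {n : ℕ} :
    initSeg n t ∈ A.delayPoly s E n ↔ A.FiresAlong s E t n :=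
  ⟨fun h => FiresAlong.congr h le_rfl (fun _ _ => rfl) fun _ hj => extZero_initSeg t hj,
    fun h => h.congr le_rfl (fun _ _ => rfl) fun _ hj => (extZero_initSeg t hj).symm⟩

theorem delayPoly_congr {s : L × Val X} {E E' : ℕ → TAEdge L X} {n : ℕ}
    (hE : ∀ j < n, E j = E' j) : A.delayPoly s E n = A.delayPoly s E' n :=
  Set.ext fun _ => ⟨fun h => FiresAlong.congr h le_rfl hE fun _ _ => rfl,
    fun h => FiresAlong.congr h le_rfl (fun j hj => (hE j hj).symm) fun _ _ => rfl⟩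

theorem restr_mem_delayPoly {s : L × Val X} {E : ℕ → TAEdge L X} {n m : ℕ} {u : Fin n → ℝ}
    (hu : u ∈ A.delayPoly s E n) (hm : m ≤ n) : restr m u ∈ A.delayPoly s E m :=
  FiresAlong.congr hu hm (fun _ _ => rfl) fun _ hj => (extZero_restr u hj).symm

/-- Clock values are affine in the delays and every constraint is an interval. -/
theorem convex_delayPoly (s : L × Val X) (E : ℕ → TAEdge L X) (n : ℕ) :
    Convex ℝ (A.delayPoly s E n) := by
  intro u hu u' hu' a b ha hb hab i hi
  have h0 := extZero_nonneg fun j hj => (hu j hj).1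
  have h0' := extZero_nonneg fun j hj => (hu' j hj).1
  have he : extZero (a • u + b • u') = a • extZero u + b • extZero u' := by
    ext j; simp only [extZero, Pi.add_apply, Pi.smul_apply, smul_eq_mul]; split_ifs <;> simp
  have hnn : 0 ≤ a * extZero u i + b * extZero u' i :=
    add_nonneg (mul_nonneg ha (h0 i)) (mul_nonneg hb (h0' i))
  rw [he]
  refine ⟨hnn, ?_⟩
  have h1 := (hu i hi).2
  have h2 := (hu' i hi).2
  rw [← Prod.mk.eta (p := stateAlong s E _ i)] at h1 h2 ⊢
  rw [stateAlong_fst s E _ (a • extZero u + b • extZero u')] at h1 h2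
  have key := stateAlong_convexCombination s E h0 h0' ha hb hab i
  refine h1.of_mem_uIcc h2 (fun x => convexCombination_mem_uIcc ha hb hab (key x)) fun x =>
    convexCombination_mem_uIcc ha hb hab ?_
  push_cast
  rw [key, Real.coe_toNNReal _ (h0 i), Real.coe_toNNReal _ (h0' i)]
  rw [Real.coe_toNNReal]
  · simp; ring
  · exact hnn

theorem isLocallyClosed_delayPoly (s : L × Val X) (E : ℕ → TAEdge L X) (n : ℕ) :
    IsLocallyClosed (A.delayPoly s E n) := by
  -- The locations depend on the edges alone, so they are computed with the zero delays; this leaves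
  -- conditions on a continuous function of u.
  have : A.delayPoly s E n = ⋂ i ∈ Finset.range n, ({u | 0 ≤ extZero u i} ∩
      (fun u => ((stateAlong s E (extZero u) i).2, (extZero u i).toNNReal)) ⁻¹'
        {p | A.Fires ((stateAlong s E 0 i).1, p.1) p.2 (E i)}) := by
    ext u
    simp only [Finset.mem_range, Set.mem_iInter]
    refine forall₂_congr fun i hi => and_congr Iff.rfl ?_
    rw [Set.mem_preimage, Set.mem_ofPred_eq, stateAlong_fst s E 0 (extZero u)]
  rw [this]
  have hc : ∀ i, Continuous fun u : Fin n → ℝ => extZero u i :=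
    fun i => (continuous_apply i).comp continuous_extZero
  exact IsLocallyClosed.biInter_finset _ fun i _ =>
    (isClosed_le continuous_const (hc i)).isLocallyClosed.inter
      ((isLocallyClosed_setOf_fires _ _).preimage
        (((continuous_stateAlong_snd s E i).comp continuous_extZero).prodMk
          (continuous_real_toNNReal.comp (hc i))))

/-- The intermediate states of a finite run are determined by its delays and edges, so the
existential over state sequences disappears. -/
theorem pol_eq (s : L × Val X) (E : ℕ → TAEdge L X) {n : ℕ} (C : Set (Fin n → ℝ)) :
    A.Pol s (fun i : Fin n => E i) C = C ∩ A.delayPoly s E n := by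
  ext u
  refine and_congr Iff.rfl ⟨?_, fun h => ?_⟩
  · rintro ⟨τ, hτ, σ, h0, hσ⟩
    have hext : ∀ i (hi : i < n), extZero u i = τ ⟨i, hi⟩ := fun i hi => by
      rw [extZero_of_lt u hi, hτ]
    have hst : ∀ i (hi : i < n + 1), σ ⟨i, hi⟩ = stateAlong s E (extZero u) i := by
      intro i
      induction i with
      | zero => exact fun _ => h0
      | succ i ih =>
        intro hi
        have := (step_iff.1 (hσ ⟨i, by omega⟩)).2
        rw [stateAlong, ← ih (by omega), hext i (by omega), Real.toNNReal_coe]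
        exact this
    intro i hi
    rw [hext i hi, Real.toNNReal_coe, ← hst i (by omega)]
    exact ⟨NNReal.coe_nonneg _, (step_iff.1 (hσ ⟨i, hi⟩)).1⟩
  · refine ⟨fun i => (u i).toNNReal, fun i => ?_, fun i => stateAlong s E (extZero u) i, rfl,
      fun i => ?_⟩
    · have := (h i i.2).1
      rw [extZero_val] at this
      rw [Real.coe_toNNReal _ this]
    · have := (h i i.2).2
      change A.Step _ (u i).toNNReal _ _
      rw [← extZero_val u i]
      exact this

variable (A) in
/-- One-step extensions, by any edge, of the delay vectors in `D`. -/
def succDelays (s : L × Val X) (E : ℕ → TAEdge L X) (i : ℕ) (D : Set (Fin i → ℝ)) :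
    Set (Fin (i + 1) → ℝ) :=
  {t | restr i t ∈ D ∧ 0 ≤ t (Fin.last i) ∧
    ∃ e, A.Fires (stateAlong s E (extZero t) i) (t (Fin.last i)).toNNReal e}

theorem succDelays_mono {s : L × Val X} {E : ℕ → TAEdge L X} {i : ℕ} {D D' : Set (Fin i → ℝ)}
    (h : D ⊆ D') : A.succDelays s E i D ⊆ A.succDelays s E i D' := fun _ ht => ⟨h ht.1, ht.2⟩

variable (A) in
/-- Thickness of a set of delay vectors of length `n` along the edges `E`. -/
def ThickSet (s : L × Val X) (E : ℕ → TAEdge L X) {n : ℕ} (D : Set (Fin n → ℝ)) : Prop :=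
  ∀ i < n, dimH (A.succDelays s E i (restr i '' D)) ≤ dimH (restr (i + 1) '' D)

/-- The value ⊥ on the empty set plays no role once the smaller side is non-empty, so thickness can
be handled with `dimH`. -/
theorem setDim_lt_iff {V : Type*} [EMetricSpace V] {S T : Set V} (hS : S.Nonempty) :
    setDim S < setDim T ↔ dimH S < dimH T := by
  rw [setDim_of_nonempty hS]
  by_cases hT : T.Nonempty
  · rw [setDim_of_nonempty hT, WithBot.coe_lt_coe]
  · rw [setDim, if_neg hT]
    simp [Set.not_nonempty_iff_eq_empty.1 hT]

/-- The convention that the constraint of length 0 is true agrees with the projection exactly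
because the constrained polyhedron is non-empty. -/
theorem projConstraint_eq {s : L × Val X} {E : ℕ → TAEdge L X} {n : ℕ} {C : Set (Fin n → ℝ)}
    (h : (C ∩ A.delayPoly s E n).Nonempty) (m : ℕ) (hm : m ≤ n) :
    A.projConstraint s (fun i : Fin n => E i) C m hm = restr m '' (C ∩ A.delayPoly s E n) := by
  ext u
  rw [projConstraint, pol_eq]
  constructor
  · rintro (rfl | ⟨t, ht, hu⟩)
    · obtain ⟨t, ht⟩ := h
      exact ⟨t, ht, Subsingleton.elim _ _⟩
    · refine ⟨t, ht, funext fun j => ?_⟩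
      rw [hu, restr_apply]
      exact extZero_of_lt _ _
  · rintro ⟨t, ht, rfl⟩
    exact Or.inr ⟨t, ht, fun j => extZero_of_lt _ (j.2.trans_le hm)⟩

theorem mem_delayPoly_succ {s : L × Val X} {E : ℕ → TAEdge L X} {n : ℕ} {u : Fin (n + 1) → ℝ} :
    u ∈ A.delayPoly s E (n + 1) ↔ restr n u ∈ A.delayPoly s E n ∧ 0 ≤ u (Fin.last n) ∧
      A.Fires (stateAlong s E (extZero u) n) (u (Fin.last n)).toNNReal (E n) := by
  have hl : extZero u n = u (Fin.last n) := extZero_of_lt u (Nat.lt_succ_self n)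
  constructor
  · intro h
    refine ⟨restr_mem_delayPoly h (Nat.le_succ n), ?_⟩
    rw [← hl]
    exact h n (Nat.lt_succ_self n)
  · rintro ⟨h1, h2⟩ i hi
    rcases Nat.lt_succ_iff_lt_or_eq.1 hi with h | rfl
    · exact FiresAlong.congr h1 le_rfl (fun _ _ => rfl) (fun _ hj => extZero_restr u hj) i h
    · rw [hl]; exact h2

theorem iUnion_pol_snoc (s : L × Val X) (E : ℕ → TAEdge L X) (i : ℕ) {D : Set (Fin i → ℝ)}
    (hD : D ⊆ A.delayPoly s E i) :
    (⋃ e ∈ A.edges, A.Pol s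
      (Fin.snoc (α := fun _ => TAEdge L X) (fun j : Fin i => E j) e)
        {t : Fin (i + 1) → ℝ | (fun j : Fin i => t j.castSucc) ∈ D}) = A.succDelays s E i D := by
  have hsn : ∀ e, (Fin.snoc (α := fun _ => TAEdge L X) (fun j : Fin i => E j) e) =
      fun j : Fin (i + 1) => Function.update E i e j := by
    intro e
    ext1 j
    refine Fin.lastCases ?_ (fun j => ?_) j
    · simp
    · simp [Function.update_of_ne j.2.ne]
  have hr : ∀ t : Fin (i + 1) → ℝ, (fun j : Fin i => t j.castSucc) = restr i t := fun t =>
    funext fun j => (extZero_of_lt t (j.2.trans (Nat.lt_succ_self i))).symm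
  have hst : ∀ e (t : Fin (i + 1) → ℝ), stateAlong s (Function.update E i e) (extZero t) i =
      stateAlong s E (extZero t) i := fun e t =>
    stateAlong_congr (fun j hj => Function.update_of_ne hj.ne _ _) fun _ _ => rfl
  have hE : ∀ e, A.delayPoly s (Function.update E i e) i = A.delayPoly s E i := fun e =>
    delayPoly_congr fun j hj => Function.update_of_ne hj.ne _ _
  ext t
  simp only [hsn, Set.mem_iUnion, pol_eq, Set.mem_inter_iff, Set.mem_ofPred_eq, hr,
    mem_delayPoly_succ, hst, hE, Function.update_self]
  constructor
  · rintro ⟨e, -, h1, -, h2, h3⟩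
    exact ⟨h1, h2, e, h3⟩
  · rintro ⟨h1, h2, e, h3⟩
    exact ⟨e, h3.1, h1, hD h1, h2, h3⟩

theorem thickPath_iff {s : L × Val X} {E : ℕ → TAEdge L X} {n : ℕ} {C : Set (Fin n → ℝ)}
    (h : (C ∩ A.delayPoly s E n).Nonempty) :
    A.ThickPath s (fun i : Fin n => E i) C ↔ A.ThickSet s E (C ∩ A.delayPoly s E n) := by
  have hsub : ∀ i ≤ n, restr i '' (C ∩ A.delayPoly s E n) ⊆ A.delayPoly s E i := by
    rintro i hi _ ⟨t, ht, rfl⟩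
    exact restr_mem_delayPoly ht.2 hi
  rw [ThickPath, ThinPath, not_exists]
  refine ⟨fun H i hi => ?_, fun H i => ?_⟩
  · have := H ⟨i, hi⟩
    simp only [Fin.val_castLE] at this
    rw [projConstraint_eq h, projConstraint_eq h, iUnion_pol_snoc _ _ _ (hsub i hi.le), pol_eq,
      Set.inter_eq_left.2 (hsub _ hi), setDim_lt_iff (h.image _), not_lt] at this
    exact this
  · simp only [Fin.val_castLE]
    rw [projConstraint_eq h, projConstraint_eq h, iUnion_pol_snoc _ _ _ (hsub i i.2.le), pol_eq,
      Set.inter_eq_left.2 (hsub _ i.2), setDim_lt_iff (h.image _), not_lt]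
    exact H i i.2

end TimedAutomaton

/-! ### Dimension of convex sets, and a shrinking argument for closed conditions -/

/-- A linear image of a convex set and that of a relative neighbourhood of one of its points have
the same dimension. -/
theorem Convex.dimH_image_le_dimH_image_inter_ball {V W : Type*} [NormedAddCommGroup V]
    [NormedSpace ℝ V] [NormedAddCommGroup W] [NormedSpace ℝ W] {K : Set V} (hK : Convex ℝ K)
    {x : V} (hx : x ∈ K) {r : ℝ} (hr : 0 < r) (f : V →ₗ[ℝ] W) :
    dimH (f '' K) ≤ dimH (f '' (Metric.ball x r ∩ K)) := by
  -- The homothety of centre x and ratio 1/(k+1) brings a point of the convex set into the ball once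
  -- k is large. Countably many dilations of the small piece therefore cover the image, and each is
  -- Lipschitz.
  have hsub : f '' K ⊆ ⋃ k : ℕ, (fun z => f x + ((k : ℝ) + 1) • (z - f x)) ''
      (f '' (Metric.ball x r ∩ K)) := by
    rintro _ ⟨y, hy, rfl⟩
    obtain ⟨k, hk⟩ := exists_nat_gt (‖y - x‖ / r)
    have hk1 : (0 : ℝ) < k + 1 := by positivity
    refine Set.mem_iUnion.2 ⟨k, f (x + ((k : ℝ) + 1)⁻¹ • (y - x)), ⟨_, ⟨?_, ?_⟩, rfl⟩, ?_⟩
    · rw [Metric.mem_ball, dist_eq_norm, add_sub_cancel_left, norm_smul, norm_inv,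
        Real.norm_of_nonneg hk1.le, inv_mul_lt_iff₀ hk1]
      rw [div_lt_iff₀ hr] at hk
      linarith
    · exact hK.add_smul_sub_mem hx hy ⟨by positivity, inv_le_one_of_one_le₀ (by linarith [Nat.cast_nonneg (α := ℝ) k])⟩
    · simp only [map_add, map_smul, map_sub, add_sub_cancel_left, smul_smul,
        mul_inv_cancel₀ hk1.ne', one_smul]
      abel
  refine (dimH_mono hsub).trans ?_
  rw [dimH_iUnion]
  refine iSup_le fun k => ?_
  have hl : LipschitzWith (k + 1) fun z : W => f x + ((k : ℝ) + 1) • (z - f x) := by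
    refine LipschitzWith.of_dist_le_mul fun a b => le_of_eq ?_
    rw [dist_add_left, dist_smul₀, dist_sub_right, Real.norm_of_nonneg (by positivity)]
    push_cast
    rfl
  exact hl.dimH_image_le _

theorem Convex.dimH_le_dimH_inter_ball {V : Type*} [NormedAddCommGroup V]
    [NormedSpace ℝ V] {K : Set V} (hK : Convex ℝ K)
    {x : V} (hx : x ∈ K) {r : ℝ} (hr : 0 < r) : dimH K ≤ dimH (Metric.ball x r ∩ K) := by
  simpa using hK.dimH_image_le_dimH_image_inter_ball hx hr LinearMap.id

theorem restr_snoc {n : ℕ} (u : Fin n → ℝ) (y : ℝ) :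
    restr n (Fin.snoc (α := fun _ => ℝ) u y : Fin (n + 1) → ℝ) = u := by
  ext j
  rw [restr_apply, extZero_of_lt _ (j.2.trans (Nat.lt_succ_self n))]
  exact Fin.snoc_castSucc (α := fun _ => ℝ) y u j

theorem snoc_restr {n : ℕ} (u : Fin (n + 1) → ℝ) :
    (Fin.snoc (α := fun _ => ℝ) (restr n u) (u (Fin.last n)) : Fin (n + 1) → ℝ) = u := by
  ext j
  refine Fin.lastCases ?_ (fun j => ?_) j
  · simp
  · rw [Fin.snoc_castSucc, restr_apply]
    exact extZero_of_lt _ (j.2.trans (Nat.lt_succ_self n))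

theorem initSeg_succ (n : ℕ) (t : ℕ → ℝ) :
    initSeg (n + 1) t = Fin.snoc (α := fun _ => ℝ) (initSeg n t) (t n) := by
  have h := snoc_restr (initSeg (n + 1) t)
  rw [restr_initSeg t (Nat.le_succ n)] at h
  exact h.symm

theorem dist_snoc_le_iff {n : ℕ} {u v : Fin n → ℝ} {y z r : ℝ} :
    dist (Fin.snoc (α := fun _ => ℝ) u y : Fin (n + 1) → ℝ) (Fin.snoc (α := fun _ => ℝ) v z) ≤ r ↔
      dist u v ≤ r ∧ dist y z ≤ r := by
  constructor
  · intro h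
    have hr := dist_nonneg.trans h
    rw [dist_pi_le_iff hr] at h
    refine ⟨(dist_pi_le_iff hr).2 fun j => ?_, ?_⟩
    · simpa using h j.castSucc
    · simpa using h (Fin.last n)
  · rintro ⟨h1, h2⟩
    have hr := dist_nonneg.trans h2
    rw [dist_pi_le_iff hr] at h1 ⊢
    intro j
    refine Fin.lastCases ?_ (fun j => ?_) j
    · simpa using h2
    · simpa using h1 j

theorem dist_snoc {n : ℕ} (u v : Fin n → ℝ) (y z : ℝ) :
    dist (Fin.snoc (α := fun _ => ℝ) u y : Fin (n + 1) → ℝ) (Fin.snoc (α := fun _ => ℝ) v z) =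
      max (dist u v) (dist y z) :=
  eq_of_forall_ge_iff fun r => by rw [dist_snoc_le_iff, max_le_iff]

theorem dist_restr_le {n m : ℕ} (u v : Fin n → ℝ) : dist (restr m u) (restr m v) ≤ dist u v := by
  refine (dist_pi_le_iff dist_nonneg).2 fun j => ?_
  simp only [restr_apply, extZero]
  split_ifs with h
  · exact dist_le_pi_dist u v _
  · simp

theorem lipschitzWith_restr (n m : ℕ) : LipschitzWith 1 (restr m : (Fin n → ℝ) → Fin m → ℝ) :=
  LipschitzWith.of_dist_le_mul fun u v => by simpa using dist_restr_le u v

/-- Thickening a convex set by an interval in a new direction increases its dimension. -/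
theorem Convex.dimH_lt_dimH_cylinder {n : ℕ} {D : Set (Fin n → ℝ)} (hD : Convex ℝ D)
    (hne : D.Nonempty) {a b : ℝ} (hab : a < b) :
    dimH D < dimH {t : Fin (n + 1) → ℝ | restr n t ∈ D ∧ t (Fin.last n) ∈ Set.Ioo a b} := by
  set S := {t : Fin (n + 1) → ℝ | restr n t ∈ D ∧ t (Fin.last n) ∈ Set.Ioo a b}
  have hS : Convex ℝ S := by
    refine (hD.linear_preimage (restr n)).inter ?_
    exact (convex_Ioo a b).linear_preimage
      (LinearMap.proj (R := ℝ) (φ := fun _ : Fin (n + 1) => ℝ) (Fin.last n))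
  have hmem : ∀ u ∈ D, ∀ y ∈ Set.Ioo a b,
      (Fin.snoc (α := fun _ => ℝ) u y : Fin (n + 1) → ℝ) ∈ S := by
    intro u hu y hy
    refine ⟨by rwa [restr_snoc], by simpa using hy⟩
  obtain ⟨u, hu⟩ := hne
  obtain ⟨y, hy⟩ := exists_between hab
  obtain ⟨z, hz⟩ := exists_between hy.2
  have hzI : z ∈ Set.Ioo a b := ⟨hy.1.trans hz.1, hz.2⟩
  rw [Real.Convex.dimH_eq_finrank_vectorSpan hD ⟨u, hu⟩,
    Real.Convex.dimH_eq_finrank_vectorSpan hS ⟨_, hmem u hu y hy⟩]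
  norm_cast
  set W := vectorSpan ℝ S
  have h1 : vectorSpan ℝ D ≤ W.map (restr n) := by
    have : Submodule.map (restr n) W = vectorSpan ℝ (restr n '' S) :=
      AffineMap.map_vectorSpan (restr n : (Fin (n+1) → ℝ) →ₗ[ℝ] _).toAffineMap
    rw [this]
    exact vectorSpan_mono ℝ fun w hw => ⟨_, hmem w hw y hy, restr_snoc w y⟩
  -- Rank-nullity for the projection restricted to the span of the cylinder: its range contains the
  -- span of D, and its kernel contains a non-zero vertical vector.
  have h2 := LinearMap.finrank_range_add_finrank_ker ((restr n).domRestrict W)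
  rw [LinearMap.range_domRestrict] at h2
  have h3 : 0 < Module.finrank ℝ (LinearMap.ker ((restr n).domRestrict W)) := by
    refine (Module.finrank_pos_iff_exists_ne_zero (R := ℝ)
      (M := LinearMap.ker ((restr n).domRestrict W))).2 ?_
    have hd : (Fin.snoc (α := fun _ => ℝ) u z : Fin (n + 1) → ℝ) -
        (Fin.snoc (α := fun _ => ℝ) u y : Fin (n + 1) → ℝ) ∈ W :=
      vsub_mem_vectorSpan ℝ (hmem u hu z hzI) (hmem u hu y hy)
    refine ⟨⟨⟨_, hd⟩, ?_⟩, fun h0 => ?_⟩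
    · rw [LinearMap.mem_ker, LinearMap.domRestrict_apply, map_sub, restr_snoc, restr_snoc, sub_self]
    · have := congrFun (congrArg (fun w => ((w : W) : Fin (n + 1) → ℝ)) (congrArg Subtype.val h0))
        (Fin.last n)
      simp at this
      linarith [hz.1]
  have h4 := Submodule.finrank_mono h1
  omega

/-- Finitely many closed conditions become constant on some non-empty open part. -/
theorem exists_isOpen_const_of_isClosed {Z ι : Type*} [TopologicalSpace Z] [Finite ι]
    {F : ι → Set Z} (hF : ∀ i, IsClosed (F i)) {K W : Set Z} (hW : IsOpen W)
    (hne : (W ∩ K).Nonempty) :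
    ∃ W', IsOpen W' ∧ W' ⊆ W ∧ (W' ∩ K).Nonempty ∧
      ∀ i, ∀ u ∈ W' ∩ K, ∀ v ∈ W' ∩ K, u ∈ F i ↔ v ∈ F i := by
  classical
  cases nonempty_fintype ι
  suffices H : ∀ s : Finset ι, ∃ W', IsOpen W' ∧ W' ⊆ W ∧ (W' ∩ K).Nonempty ∧
      ∀ i ∈ s, ∀ u ∈ W' ∩ K, ∀ v ∈ W' ∩ K, u ∈ F i ↔ v ∈ F i by
    simpa using H Finset.univ
  intro s
  induction s using Finset.induction_on with
  | empty => exact ⟨W, hW, subset_rfl, hne, by simp⟩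
  | insert j s hj ih =>
    obtain ⟨W', h1, h2, h3, h4⟩ := ih
    -- Either part of K escapes the closed set, and restricting to the open complement makes the
    -- condition false throughout, or the condition already holds throughout.
    by_cases hc : ((W' ∩ (F j)ᶜ) ∩ K).Nonempty
    · refine ⟨W' ∩ (F j)ᶜ, h1.inter (hF j).isOpen_compl, Set.inter_subset_left.trans h2, hc, ?_⟩
      intro i hi u hu v hv
      rcases Finset.mem_insert.1 hi with rfl | hi
      · exact iff_of_false hu.1.2 hv.1.2
      · exact h4 i hi u ⟨hu.1.1, hu.2⟩ v ⟨hv.1.1, hv.2⟩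
    · refine ⟨W', h1, h2, h3, fun i hi u hu v hv => ?_⟩
      have hall : ∀ w ∈ W' ∩ K, w ∈ F j := fun w hw => by
        by_contra hwF
        exact hc ⟨w, ⟨hw.1, hwF⟩, hw.2⟩
      rcases Finset.mem_insert.1 hi with rfl | hi
      · exact iff_of_true (hall u hu) (hall v hv)
      · exact h4 i hi u hu v hv

/-! ### Restricting and extending thick sets -/

namespace TimedAutomaton

variable {L X AP : Type*} {A : TimedAutomaton L X AP}

theorem succDelays_congr {s : L × Val X} {E E' : ℕ → TAEdge L X} {i : ℕ} (hE : ∀ j < i, E j = E' j)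
    (D : Set (Fin i → ℝ)) : A.succDelays s E i D = A.succDelays s E' i D := by
  ext t
  rw [succDelays, succDelays, Set.mem_ofPred_eq, Set.mem_ofPred_eq,
    stateAlong_congr hE fun _ _ => rfl]

theorem dimH_restr_delayPoly_le {s : L × Val X} {E : ℕ → TAEdge L X} {n : ℕ} {x : Fin n → ℝ}
    (hx : x ∈ A.delayPoly s E n) {r : ℝ} (hr : 0 < r) (i : ℕ) :
    dimH (restr i '' A.delayPoly s E n) ≤
      dimH (restr i '' (Metric.ball x r ∩ A.delayPoly s E n)) :=
  (convex_delayPoly s E n).dimH_image_le_dimH_image_inter_ball hx hr _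

/-- Shrinking D can only lower the dimension of the one-step extensions, whereas the projections
keep theirs: by convexity a relative ball has projections of the same dimension as the whole
polyhedron. -/
theorem ThickSet.mono {s : L × Val X} {E : ℕ → TAEdge L X} {n : ℕ} {D D' : Set (Fin n → ℝ)}
    (h : A.ThickSet s E D) (hD : D ⊆ A.delayPoly s E n) (hD' : D' ⊆ D) {x : Fin n → ℝ}
    (hx : x ∈ A.delayPoly s E n) {r : ℝ} (hr : 0 < r)
    (hb : Metric.ball x r ∩ A.delayPoly s E n ⊆ D') : A.ThickSet s E D' := fun i hi =>
  calc dimH (A.succDelays s E i (restr i '' D'))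
      ≤ dimH (A.succDelays s E i (restr i '' D)) := dimH_mono (succDelays_mono (Set.image_mono hD'))
    _ ≤ dimH (restr (i + 1) '' D) := h i hi
    _ ≤ dimH (restr (i + 1) '' A.delayPoly s E n) := dimH_mono (Set.image_mono hD)
    _ ≤ _ := dimH_restr_delayPoly_le hx hr _
    _ ≤ _ := dimH_mono (Set.image_mono hb)

/-- The inequalities below level n are inherited as in `ThickSet.mono`, since the projection of D'
still contains a relative ball; only the new level has to be supplied. -/
theorem ThickSet.extend {s : L × Val X} {E : ℕ → TAEdge L X} {e : TAEdge L X} {n : ℕ}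
    {D : Set (Fin n → ℝ)} {D' : Set (Fin (n + 1) → ℝ)}
    (h : A.ThickSet s E D) (hD : D ⊆ A.delayPoly s E n) (hD' : restr n '' D' ⊆ D) {x : Fin n → ℝ}
    (hx : x ∈ A.delayPoly s E n) {r : ℝ} (hr : 0 < r)
    (hb : Metric.ball x r ∩ A.delayPoly s E n ⊆ restr n '' D')
    (hlast : dimH (A.succDelays s E n D) ≤ dimH D') :
    A.ThickSet s (Function.update E n e) D' := by
  intro i hi
  have hE : ∀ j < i, Function.update E n e j = E j := fun j hj =>
    Function.update_of_ne (by omega) _ _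
  have him : ∀ k ≤ n, restr k '' D' = restr k '' (restr n '' D') := fun k hk => by
    rw [Set.image_image]
    exact Set.image_congr fun u _ => (restr_restr u hk).symm
  rw [succDelays_congr hE, him i (by omega)]
  rcases Nat.lt_succ_iff_lt_or_eq.1 hi with hi' | rfl
  · rw [him (i + 1) (by omega)]
    exact h.mono hD hD' hx hr hb i hi'
  · have e1 : restr (i + 1) '' D' = D' := by simp
    have e2 : restr i '' (restr i '' D') = restr i '' D' := by simp
    rw [e1, e2]
    exact (dimH_mono (succDelays_mono hD')).trans hlast

/-- A set of delay vectors whose last delay is determined by the value of some clock when the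
transition is taken has at most the dimension of the set of shorter delay vectors. -/
theorem dimH_le_of_clock_eq [Finite X] (s : L × Val X) (E : ℕ → TAEdge L X) {n : ℕ}
    {D : Set (Fin n → ℝ)} {S : Set (Fin (n + 1) → ℝ)} (hS : ∀ t ∈ S, restr n t ∈ D ∧
      ∃ x, ∃ c : ℕ, ((stateAlong s E (extZero t) n).2 x : ℝ) + t (Fin.last n) = c) :
    dimH S ≤ dimH D := by
  have : Countable X := Finite.to_countable
  -- Solving the clock equation for the last delay writes S as part of a countable union of graphs
  -- of Lipschitz functions over D.
  let f : X → ℕ → (Fin n → ℝ) → (Fin (n + 1) → ℝ) := fun x c u =>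
    Fin.snoc (α := fun _ => ℝ) u (c - ((stateAlong s E (extZero u) n).2 x : ℝ))
  have hsub : S ⊆ ⋃ x, ⋃ c, f x c '' D := by
    intro t ht
    obtain ⟨h1, x, c, h2⟩ := hS t ht
    refine Set.mem_iUnion.2 ⟨x, Set.mem_iUnion.2 ⟨c, _, h1, ?_⟩⟩
    simp only [f]
    rw [stateAlong_extZero_restr t le_rfl, ← h2, add_sub_cancel_left, snoc_restr]
  refine (dimH_mono hsub).trans ?_
  rw [dimH_iUnion]
  refine iSup_le fun x => ?_
  rw [dimH_iUnion]
  refine iSup_le fun c => ?_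
  obtain ⟨K, hK⟩ := exists_lipschitzWith_stateAlong s E n n x
  have hl : LipschitzWith (max 1 K) (f x c) := by
    refine LipschitzWith.of_dist_le_mul fun u v => ?_
    rw [dist_snoc, dist_sub_left]
    refine max_le ?_ ((hK.dist_le_mul u v).trans ?_)
    · exact le_mul_of_one_le_left dist_nonneg (by exact_mod_cast le_max_left 1 K)
    · gcongr
      exact le_max_right 1 K
  exact hl.dimH_image_le D

variable [Fintype L]

/-- An edge fired in a time-open region can be fired in this region also from the nearby states in
the same region, after nearby delays. -/
theorem exists_ball_fires_of_timeOpen [Finite X] {s : L × Val X} {E : ℕ → TAEdge L X} {n : ℕ}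
    {a : Fin n → ℝ} {τ : ℝ≥0} {e : TAEdge L X}
    (h : A.Fires (stateAlong s E (extZero a) n) τ e)
    (ho : TimeOpen A.maxConst ((stateAlong s E (extZero a) n).2.delay τ)) :
    ∃ δ > 0, ∀ u ∈ Metric.ball (Fin.snoc (α := fun _ => ℝ) a (τ : ℝ) : Fin (n + 1) → ℝ) δ,
      A.reg (stateAlong s E (extZero u) n) = A.reg (stateAlong s E (extZero a) n) →
      A.Fires (stateAlong s E (extZero u) n) (u (Fin.last n)).toNNReal e ∧
      A.reg (next (stateAlong s E (extZero u) n) (u (Fin.last n)).toNNReal e) =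
        A.reg (next (stateAlong s E (extZero a) n) τ e) := by
  have hc : Continuous fun u : Fin (n + 1) → ℝ =>
      ((stateAlong s E (extZero u) n).2, (u (Fin.last n)).toNNReal) :=
    ((continuous_stateAlong_snd s E n).comp continuous_extZero).prodMk
      (continuous_real_toNNReal.comp (continuous_apply _))
  have hv := hc.tendsto (Fin.snoc (α := fun _ => ℝ) a (τ : ℝ))
  rw [← stateAlong_extZero_restr _ le_rfl, restr_snoc, Fin.snoc_last, Real.toNNReal_coe] at hv
  obtain ⟨δ, hδ, hb⟩ := Metric.eventually_nhds_iff_ball.1 (hv.eventually ho.eventually_regionEquiv)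
  refine ⟨δ, hδ, fun u hu hreg => ?_⟩
  obtain ⟨h1, h2⟩ := reg_eq_iff.1 hreg.symm
  have h3 : RegionEquiv A.maxConst ((stateAlong s E (extZero a) n).2.delay τ)
      ((stateAlong s E (extZero u) n).2.delay (u (Fin.last n)).toNNReal) := hb u hu h2
  have h4 : A.reg (next (stateAlong s E (extZero a) n) τ e) =
      A.reg (next (stateAlong s E (extZero u) n) (u (Fin.last n)).toNNReal e) :=
    reg_eq_iff.2 ⟨rfl, h3.reset e.resets⟩
  refine ⟨?_, h4.symm⟩
  rw [← Prod.mk.eta (p := stateAlong s E (extZero u) n), ← h1]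
  exact h.congr h2 h3

/-- If some edge fires in a time-open region then one-step extensions increase the dimension. -/
theorem HasOpen.dimH_lt_dimH_succDelays [Finite X] {s : L × Val X} {E : ℕ → TAEdge L X} {n : ℕ}
    {D : Set (Fin n → ℝ)} (hD : Convex ℝ D) {a : Fin n → ℝ} (ha : a ∈ D)
    (hreg : ∀ u ∈ D, A.reg (stateAlong s E (extZero u) n) = A.reg (stateAlong s E (extZero a) n))
    (h : A.HasOpen (stateAlong s E (extZero a) n)) : dimH D < dimH (A.succDelays s E n D) := by
  obtain ⟨τ, e, h1, h2⟩ := h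
  obtain ⟨δ, hδ, hb⟩ := exists_ball_fires_of_timeOpen h1 h2
  -- Near a, all last delays in (τ, τ + δ) fire the same edge, so the extensions contain a cylinder
  -- over a piece of D of full dimension.
  refine (hD.dimH_le_dimH_inter_ball ha hδ).trans_lt
    ((((convex_ball a δ).inter hD).dimH_lt_dimH_cylinder ⟨a, Metric.mem_ball_self hδ, ha⟩
      (show (τ : ℝ) < τ + δ by linarith)).trans_le (dimH_mono ?_))
  rintro t ⟨⟨ht1, ht2⟩, ht3, ht4⟩
  refine ⟨ht2, τ.2.trans ht3.le, e, (hb t ?_ ?_).1⟩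
  · rw [← snoc_restr t, Metric.mem_ball, dist_snoc, Real.dist_eq]
    exact max_lt ht1 (by rw [abs_lt]; constructor <;> linarith)
  · rw [← hreg _ ht2, stateAlong_extZero_restr t le_rfl]

end TimedAutomaton

/-! ### Thick cylinders -/

namespace TimedAutomaton

variable {L X AP : Type*} [Fintype L] (A : TimedAutomaton L X AP)

/-- The ball of radius `r` around the delays `x` defines a thick cylinder along the edges `E` all of
whose runs follow the same path of the thick graph. -/
structure IsThickCylinder (s : L × Val X) (n : ℕ) (E : ℕ → TAEdge L X) (x : ℕ → ℝ) (r : ℝ) :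
    Prop where
  pos : 0 < r
  fires : A.FiresAlong s E x n
  thick : A.ThickSet s E (Metric.ball (initSeg n x) r ∩ A.delayPoly s E n)
  reg_eq : ∀ u ∈ Metric.ball (initSeg n x) r ∩ A.delayPoly s E n, ∀ i ≤ n,
    A.reg (stateAlong s E (extZero u) i) = A.reg (stateAlong s E x i)
  graph : ∀ i < n, A.ThickGraph (A.reg (stateAlong s E x i)) (A.reg (stateAlong s E x (i + 1)))

variable {A}

namespace IsThickCylinder

variable {s : L × Val X} {n : ℕ} {E : ℕ → TAEdge L X} {x : ℕ → ℝ} {r r' : ℝ}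

theorem mem_delayPoly (h : A.IsThickCylinder s n E x r) : initSeg n x ∈ A.delayPoly s E n :=
  mem_delayPoly_initSeg.2 h.fires

theorem mono (h : A.IsThickCylinder s n E x r) (hr' : 0 < r') (hle : r' ≤ r) :
    A.IsThickCylinder s n E x r' where
  pos := hr'
  fires := h.fires
  thick := h.thick.mono Set.inter_subset_right
    (Set.inter_subset_inter_left _ (Metric.ball_subset_ball hle)) h.mem_delayPoly hr' subset_rfl
  reg_eq u hu := h.reg_eq u ⟨Metric.ball_subset_ball hle hu.1, hu.2⟩
  graph := h.graph

theorem zero (s : L × Val X) (E : ℕ → TAEdge L X) (x : ℕ → ℝ) :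
    A.IsThickCylinder s 0 E x 1 where
  pos := one_pos
  fires i hi := by omega
  thick i hi := by omega
  reg_eq u _ i hi := by obtain rfl : i = 0 := by omega
                        rfl
  graph i hi := by omega

/-- A time-open step leaves the last delay free near τ, so the new polyhedron contains a
neighbourhood in the largest conceivable set of extensions. If no time-open step exists, every
possible last delay is fixed by a clock equation, so no extension can gain dimension over the base.
-/
theorem extend [Finite X] (h : A.IsThickCylinder s n E x r) {τ : ℝ≥0} {e : TAEdge L X}
    (ht : A.ThickStep (stateAlong s E x n) τ e) :
    ∃ r' ≤ r, A.IsThickCylinder s (n + 1) (Function.update E n e) (Function.update x n τ) r' := by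
  set E' := Function.update E n e
  set x' := Function.update x n (τ : ℝ)
  have hEj : ∀ j < n, E' j = E j := fun j hj => Function.update_of_ne hj.ne _ _
  have hxj : ∀ j < n, x' j = x j := fun j hj => Function.update_of_ne hj.ne _ _
  have hEn : E' n = e := Function.update_self _ _ _
  have hxn : x' n = τ := Function.update_self _ _ _
  have hst : ∀ (t : ℕ → ℝ) i, i ≤ n → stateAlong s E' t i = stateAlong s E t i :=
    fun t i hi => stateAlong_congr (fun j hj => hEj j (hj.trans_le hi)) fun _ _ => rfl
  have hst' : ∀ i ≤ n, stateAlong s E' x' i = stateAlong s E x i := fun i hi =>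
    stateAlong_congr (fun j hj => hEj j (hj.trans_le hi)) fun j hj => hxj j (hj.trans_le hi)
  have hlast : stateAlong s E' x' (n + 1) = next (stateAlong s E x n) τ e := by
    rw [stateAlong, hst' n le_rfl, hEn, hxn, Real.toNNReal_coe]
  have hinit : initSeg n x' = initSeg n x := funext fun j => hxj j j.2
  have hinit' : initSeg (n + 1) x' = Fin.snoc (α := fun _ => ℝ) (initSeg n x) (τ : ℝ) := by
    rw [initSeg_succ, hinit, hxn]
  have hfires : A.FiresAlong s E' x' (n + 1) := by
    intro i hi
    rcases Nat.lt_succ_iff_lt_or_eq.1 hi with hi | rfl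
    · rw [hst' i hi.le, hEj i hi, hxj i hi]; exact h.fires i hi
    · rw [hst' i le_rfl, hEn, hxn, Real.toNNReal_coe]; exact ⟨τ.2, ht.1⟩
  have hmem : ∀ u : Fin (n + 1) → ℝ, u ∈ A.delayPoly s E' (n + 1) ↔
      restr n u ∈ A.delayPoly s E n ∧ 0 ≤ u (Fin.last n) ∧
        A.Fires (stateAlong s E (extZero u) n) (u (Fin.last n)).toNNReal e := by
    intro u
    rw [mem_delayPoly_succ, delayPoly_congr hEj, hst _ n le_rfl, hEn]
  have hball : ∀ (u : Fin (n + 1) → ℝ) (ρ : ℝ), u ∈ Metric.ball (initSeg (n + 1) x') ρ ↔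
      restr n u ∈ Metric.ball (initSeg n x) ρ ∧ dist (u (Fin.last n)) τ < ρ := by
    intro u ρ
    conv_lhs => rw [hinit', ← snoc_restr u, Metric.mem_ball, dist_snoc, max_lt_iff]
    rfl
  have hgraph : ∀ i < n + 1, A.ThickGraph (A.reg (stateAlong s E' x' i))
      (A.reg (stateAlong s E' x' (i + 1))) := by
    intro i hi
    rcases Nat.lt_succ_iff_lt_or_eq.1 hi with hi | rfl
    · rw [hst' i hi.le, hst' (i + 1) hi]; exact h.graph i hi
    · rw [hst' i le_rfl, hlast]; exact ht.thickGraph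
  have hext0 : ∀ i ≤ n, stateAlong s E (extZero (initSeg n x)) i = stateAlong s E x i := fun i hi =>
    stateAlong_congr (fun _ _ => rfl) fun j hj => extZero_initSeg x (hj.trans_le hi)
  have hreg : ∀ u : Fin (n + 1) → ℝ, restr n u ∈ Metric.ball (initSeg n x) r →
      restr n u ∈ A.delayPoly s E n → ∀ i ≤ n,
      A.reg (stateAlong s E (extZero u) i) = A.reg (stateAlong s E x i) := by
    intro u h1 h2 i hi
    rw [← stateAlong_extZero_restr u hi]
    exact h.reg_eq _ ⟨h1, h2⟩ i hi
  rcases ht.2 with ho | ho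
  · have htf := ht.1
    rw [← hext0 n le_rfl] at htf ho
    obtain ⟨δ, hδ, hb⟩ := exists_ball_fires_of_timeOpen htf ho
    rw [← hinit'] at hb
    set ρ := min r δ
    have hρ : 0 < ρ := lt_min h.pos hδ
    have hfr : ∀ u ∈ Metric.ball (initSeg (n + 1) x') ρ, restr n u ∈ A.delayPoly s E n →
        A.Fires (stateAlong s E (extZero u) n) (u (Fin.last n)).toNNReal e ∧
        A.reg (next (stateAlong s E (extZero u) n) (u (Fin.last n)).toNNReal e) =
        A.reg (next (stateAlong s E x n) τ e) := by
      intro u hu hun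
      have := hb u (Metric.ball_subset_ball (min_le_right _ _) hu) (by
        rw [hext0 n le_rfl]
        exact hreg u (Metric.ball_subset_ball (min_le_left _ _) ((hball u ρ).1 hu).1) hun n le_rfl)
      rwa [hext0 n le_rfl] at this
    refine ⟨ρ, min_le_left _ _, hρ, hfires, ?_, ?_, hgraph⟩
    · refine h.thick.extend Set.inter_subset_right ?_ h.mem_delayPoly hρ ?_ ?_
      · rintro _ ⟨u, ⟨hu1, hu2⟩, rfl⟩
        exact ⟨Metric.ball_subset_ball (min_le_left _ _) ((hball u ρ).1 hu1).1, ((hmem u).1 hu2).1⟩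
      · rintro w ⟨hw1, hw2⟩
        have hwb : (Fin.snoc (α := fun _ => ℝ) w (τ : ℝ) : Fin (n + 1) → ℝ) ∈
            Metric.ball (initSeg (n + 1) x') ρ := by
          rw [hball, restr_snoc]
          exact ⟨hw1, by simpa using hρ⟩
        refine ⟨Fin.snoc (α := fun _ => ℝ) w (τ : ℝ), ⟨hwb, ?_⟩, restr_snoc _ _⟩
        rw [hmem]
        refine ⟨by rwa [restr_snoc], by simp, (hfr _ hwb (by rwa [restr_snoc])).1⟩
      -- The extensions by arbitrary edges need not form a convex set, but they lie in the convex
      -- set Q, which keeps only the old constraints and the sign of the last delay. Near the new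
      -- centre Q coincides with the new polyhedron.
      · let Q : Set (Fin (n + 1) → ℝ) := {u | restr n u ∈ A.delayPoly s E n ∧ 0 ≤ u (Fin.last n)}
        have hQ : Convex ℝ Q := by
          refine ((convex_delayPoly s E n).linear_preimage (restr n)).inter ?_
          exact (convex_Ici (0 : ℝ)).linear_preimage
            (LinearMap.proj (R := ℝ) (φ := fun _ : Fin (n + 1) => ℝ) (Fin.last n))
        have hxQ : initSeg (n + 1) x' ∈ Q := by
          refine ⟨?_, ?_⟩
          · rw [restr_initSeg _ (Nat.le_succ n), hinit]; exact h.mem_delayPoly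
          · rw [hinit']; simp
        have hsQ : A.succDelays s E n (Metric.ball (initSeg n x) r ∩ A.delayPoly s E n) ⊆ Q :=
          fun t ht' => ⟨ht'.1.2, ht'.2.1⟩
        have hQs : Metric.ball (initSeg (n + 1) x') ρ ∩ Q ⊆
            Metric.ball (initSeg (n + 1) x') ρ ∩ A.delayPoly s E' (n + 1) :=
          fun u hu => ⟨hu.1, (hmem u).2 ⟨hu.2.1, hu.2.2, (hfr u hu.1 hu.2.1).1⟩⟩
        exact (dimH_mono hsQ).trans ((hQ.dimH_le_dimH_inter_ball hxQ hρ).trans (dimH_mono hQs))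
    · rintro u ⟨hu1, hu2⟩ i hi
      have hur := ((hball u ρ).1 hu1).1
      rcases Nat.le_succ_iff_eq_or_le.1 hi with rfl | hi
      · rw [hlast, stateAlong, hst _ n le_rfl, hEn, extZero_of_lt u (Nat.lt_succ_self n)]
        exact (hfr u hu1 ((hmem u).1 hu2).1).2
      · rw [hst _ i hi, hst' i hi]
        exact hreg u (Metric.ball_subset_ball (min_le_left _ _) hur) ((hmem u).1 hu2).1 i hi
  · have hno : ∀ u : Fin (n + 1) → ℝ, restr n u ∈ Metric.ball (initSeg n x) r →
        restr n u ∈ A.delayPoly s E n → ¬ A.HasOpen (stateAlong s E (extZero u) n) := by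
      intro u h1 h2
      rwa [hasOpen_congr (hreg u h1 h2 n le_rfl)]
    -- The last delay is left unbounded here, so that by bisimulation D' projects onto the whole
    -- base; the bound by r is imposed afterwards through `ThickSet.mono`.
    set D' : Set (Fin (n + 1) → ℝ) :=
      {u | restr n u ∈ Metric.ball (initSeg n x) r} ∩ A.delayPoly s E' (n + 1)
    have hD' : restr n '' D' = Metric.ball (initSeg n x) r ∩ A.delayPoly s E n := by
      ext w
      constructor
      · rintro ⟨u, ⟨h1, h2⟩, rfl⟩
        exact ⟨h1, ((hmem u).1 h2).1⟩
      · intro hw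
        have hwr := h.reg_eq w hw n le_rfl
        obtain ⟨t, ht1, -⟩ := ht.1.exists_of_reg_eq hwr.symm
        refine ⟨Fin.snoc (α := fun _ => ℝ) w (t : ℝ), ⟨?_, (hmem _).2 ⟨?_, ?_, ?_⟩⟩, restr_snoc _ _⟩
        · rw [Set.mem_ofPred_eq, restr_snoc]; exact hw.1
        · rw [restr_snoc]; exact hw.2
        · simp
        · rw [← stateAlong_extZero_restr _ le_rfl, restr_snoc, Fin.snoc_last, Real.toNNReal_coe]
          exact ht1
    have hthick : A.ThickSet s E' D' := by
      refine h.thick.extend Set.inter_subset_right hD'.le h.mem_delayPoly h.pos hD'.ge ?_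
      calc dimH (A.succDelays s E n _) ≤ dimH (Metric.ball (initSeg n x) r ∩ A.delayPoly s E n) := by
            refine dimH_le_of_clock_eq s E fun t ht' => ⟨ht'.1, ?_⟩
            obtain ⟨e', he'⟩ := ht'.2.2
            have hto : ¬ TimeOpen A.maxConst ((stateAlong s E (extZero t) n).2.delay
                (t (Fin.last n)).toNNReal) := fun hto =>
              hno t ht'.1.1 ht'.1.2 ⟨_, e', he', hto⟩
            obtain ⟨y, c, -, hyc⟩ := not_timeOpen_iff.1 hto
            refine ⟨y, c, ?_⟩
            have := congrArg NNReal.toReal hyc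
            rw [Val.delay, NNReal.coe_add, Real.coe_toNNReal _ ht'.2.1] at this
            simpa using this
        _ ≤ dimH D' := by
            rw [← hD']
            exact ((lipschitzWith_restr _ _).dimH_image_le _)
    refine ⟨r, le_rfl, h.pos, hfires, ?_, ?_, hgraph⟩
    · exact hthick.mono Set.inter_subset_right
        (fun u hu => ⟨((hball u r).1 hu.1).1, hu.2⟩) (mem_delayPoly_initSeg.2 hfires) h.pos subset_rfl
    · rintro u ⟨hu1, hu2⟩ i hi
      have hur := ((hball u r).1 hu1).1
      obtain ⟨h1, h2, h3⟩ := (hmem u).1 hu2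
      have hri := hreg u hur h1
      rcases Nat.le_succ_iff_eq_or_le.1 hi with rfl | hi
      · rw [hlast, stateAlong, hst _ n le_rfl, hEn, extZero_of_lt u (Nat.lt_succ_self n)]
        -- Transported to the central state, the firing of e has some delay t; since e has only one
        -- firing delay there, t = τ, and the target regions agree.
        obtain ⟨t, ht1, -, ht2⟩ := h3.exists_of_reg_eq (hri n le_rfl)
        rw [ht.1.eq_of_not_hasOpen ht1 ho]
        exact ht2
      · rw [hst _ i hi, hst' i hi]
        exact hri i hi

end IsThickCylinder

/-- Every thick set of delay vectors that is open in the polyhedron contains a thick cylinder along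
a single path of the thick graph. -/
theorem ThickSet.exists_isThickCylinder [Finite X] {s : L × Val X} {n : ℕ} {E : ℕ → TAEdge L X}
    {O : Set (Fin n → ℝ)} (hO : IsOpen O) (hne : (O ∩ A.delayPoly s E n).Nonempty)
    (h : A.ThickSet s E (O ∩ A.delayPoly s E n)) :
    ∃ x r, A.IsThickCylinder s n E x r ∧ Metric.ball (initSeg n x) r ⊆ O := by
  -- For each index the valuation before (`false`) and after (`true`) the delay is recorded.
  -- Shrinking to an open set on which their regions are constant fixes the path and the
  -- time-openness of each firing.
  let g : Fin (n + 1) × Bool → (Fin n → ℝ) → Val X := fun p u =>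
    if p.2 then (stateAlong s E (extZero u) p.1).2.delay (extZero u p.1).toNNReal
    else (stateAlong s E (extZero u) p.1).2
  have hst : ∀ i, Continuous fun u : Fin n → ℝ => (stateAlong s E (extZero u) i).2 := fun i =>
    (continuous_stateAlong_snd s E i).comp continuous_extZero
  have hg : ∀ p, Continuous (g p) := by
    rintro ⟨i, _ | _⟩
    · exact hst i
    · exact Val.continuous_delay.comp ((hst i).prodMk
        (continuous_real_toNNReal.comp ((continuous_apply _).comp continuous_extZero)))
  obtain ⟨W, hW, hWO, ⟨y, hyW, hy⟩, hconst⟩ := exists_isOpen_const_of_isClosed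
    (F := fun j : (Fin (n + 1) × Bool) × RegionAtom X A.maxConst => g j.1 ⁻¹' j.2.toSet)
    (fun j => j.2.isClosed_toSet.preimage (hg j.1)) hO hne
  obtain ⟨r, hr, hrW⟩ := Metric.isOpen_iff.1 hW y hyW
  have hyi : initSeg n (extZero y) = y := restr_self y
  have hsub : Metric.ball y r ∩ A.delayPoly s E n ⊆ W ∩ A.delayPoly s E n :=
    Set.inter_subset_inter_left _ hrW
  have hyb : y ∈ Metric.ball y r ∩ A.delayPoly s E n := ⟨Metric.mem_ball_self hr, hy⟩
  have hequiv : ∀ p, ∀ u ∈ Metric.ball y r ∩ A.delayPoly s E n,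
      RegionEquiv A.maxConst (g p u) (g p y) := fun p u hu =>
    RegionAtom.regionEquiv fun j => hconst (p, j) u (hsub hu) y (hsub hyb)
  have hreg : ∀ u ∈ Metric.ball y r ∩ A.delayPoly s E n, ∀ i ≤ n,
      A.reg (stateAlong s E (extZero u) i) = A.reg (stateAlong s E (extZero y) i) := fun u hu i hi =>
    reg_eq_iff.2 ⟨stateAlong_fst _ _ _ _ _,
      hequiv (⟨i, Nat.lt_succ_iff.2 hi⟩, false) u hu⟩
  have hthick : A.ThickSet s E (Metric.ball y r ∩ A.delayPoly s E n) :=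
    h.mono Set.inter_subset_right (Set.inter_subset_inter_left _ (hrW.trans hWO)) hy hr subset_rfl
  refine ⟨extZero y, r, ⟨hr, hy, by rwa [hyi], by rwa [hyi], fun i hi => ?_⟩,
    by rw [hyi]; exact hrW.trans hWO⟩
  have hfi := (hy i hi).2
  refine ThickStep.thickGraph ⟨hfi, ?_⟩
  -- If step i were not of maximal dimension, all its firings would satisfy a clock equation and the
  -- projection to i + 1 coordinates would gain no dimension, while some time-open firing makes the
  -- one-step extensions gain. This contradicts thickness at level i.
  by_contra! hcon
  obtain ⟨hnt, hop⟩ := hcon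
  set D := Metric.ball y r ∩ A.delayPoly s E n
  have hDi : dimH (restr i '' D) < dimH (A.succDelays s E i (restr i '' D)) := by
    refine HasOpen.dimH_lt_dimH_succDelays (a := restr i y)
      (((convex_ball y r).inter (convex_delayPoly s E n)).linear_image _) ⟨y, hyb, rfl⟩ ?_ ?_
    · rintro _ ⟨u, hu, rfl⟩
      rw [stateAlong_extZero_restr _ le_rfl, stateAlong_extZero_restr _ le_rfl]
      exact hreg u hu i hi.le
    · rwa [stateAlong_extZero_restr _ le_rfl]
  refine (hDi.trans_le (hthick i hi)).not_ge (dimH_le_of_clock_eq s E ?_)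
  rintro _ ⟨u, hu, rfl⟩
  refine ⟨⟨u, hu, (restr_restr u (Nat.le_succ i)).symm⟩, ?_⟩
  have hnu : ¬ TimeOpen A.maxConst ((stateAlong s E (extZero u) i).2.delay
      (extZero u i).toNNReal) := fun hto =>
    hnt (hto.congr (hequiv (⟨i, by omega⟩, true) u hu))
  obtain ⟨z, c, -, hzc⟩ := not_timeOpen_iff.1 hnu
  refine ⟨z, c, ?_⟩
  have := congrArg NNReal.toReal hzc
  rw [Val.delay, NNReal.coe_add, Real.coe_toNNReal _ (hu.2 i hi).1] at this
  rw [stateAlong_extZero_restr _ (Nat.le_succ i)]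
  simpa [restr_apply] using this

end TimedAutomaton

/-! ### The topology on runs -/

namespace TimedAutomaton

variable {L X AP : Type*} {A : TimedAutomaton L X AP}

/-- The delays of a run, as real numbers. -/
def Run.delays {s : L × Val X} (ρ : A.Run s) : ℕ → ℝ := fun i => ρ.delay i

theorem Run.state_eq {s : L × Val X} (ρ : A.Run s) (i : ℕ) :
    ρ.state i = stateAlong s ρ.edge ρ.delays i := by
  induction i with
  | zero => exact ρ.start
  | succ i ih =>
    rw [(step_iff.1 (ρ.step i)).2, ih, stateAlong, Run.delays, Real.toNNReal_coe]

theorem Run.firesAlong {s : L × Val X} (ρ : A.Run s) (n : ℕ) :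
    A.FiresAlong s ρ.edge ρ.delays n := fun i _ => by
  rw [← ρ.state_eq, Run.delays, Real.toNNReal_coe]
  exact ⟨NNReal.coe_nonneg _, (step_iff.1 (ρ.step i)).1⟩

theorem exists_run_of_firesAlong {s : L × Val X} {E : ℕ → TAEdge L X} {t : ℕ → ℝ}
    (h : ∀ n, A.FiresAlong s E t n) : ∃ ρ : A.Run s, ρ.edge = E ∧ ρ.delays = t := by
  refine ⟨⟨stateAlong s E t, fun i => (t i).toNNReal, E, rfl, fun i => ?_⟩, rfl, ?_⟩
  · exact (h (i + 1) i (Nat.lt_succ_self i)).2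
  · exact funext fun i => Real.coe_toNNReal _ (h (i + 1) i (Nat.lt_succ_self i)).1

open scoped Classical in
/-- In a non-blocking automaton every finite run is a prefix of an infinite one. -/
theorem NonBlocking.exists_run (hA : A.NonBlocking) {s : L × Val X} (hs : A.IsState s)
    {E : ℕ → TAEdge L X} {t : ℕ → ℝ} {n : ℕ} (h : A.FiresAlong s E t n) :
    ∃ ρ : A.Run s, (∀ i < n, ρ.edge i = E i) ∧ ∀ i < n, ρ.delays i = t i := by
  have hF : ∀ σ : L × Val X, ∃ p : ℝ≥0 × TAEdge L X, A.IsState σ → A.Fires σ p.1 p.2 := by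
    intro σ
    by_cases hσ : A.IsState σ
    · obtain ⟨τ, e, σ', h'⟩ := hA σ hσ
      exact ⟨(τ, e), fun _ => (step_iff.1 h').1⟩
    · exact ⟨(0, E 0), fun h' => absurd h' hσ⟩
  choose F hF using hF
  -- The prescribed delays and edges are used for the first n steps, and an arbitrary choice of
  -- firing afterwards; the value of F off the states is never used.
  let pick : ℕ → L × Val X → ℝ≥0 × TAEdge L X := fun i σ =>
    if i < n then ((t i).toNNReal, E i) else F σ
  let g : ℕ → L × Val X := fun i =>
    Nat.rec s (fun i σ => next σ (pick i σ).1 (pick i σ).2) i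
  let E' : ℕ → TAEdge L X := fun i => (pick i (g i)).2
  let t' : ℕ → ℝ := fun i => (pick i (g i)).1
  have hg : ∀ i, stateAlong s E' t' i = g i := by
    intro i
    induction i with
    | zero => rfl
    | succ i ih => rw [stateAlong, ih, Real.toNNReal_coe]
  have hE : ∀ i < n, E' i = E i := fun i hi => by simp [E', pick, hi]
  have ht : ∀ i < n, t' i = t i := fun i hi => by
    simp only [t', pick, hi, if_true]
    exact Real.coe_toNNReal _ (h i hi).1
  have hf : ∀ m, A.FiresAlong s E' t' m := by
    intro m
    induction m with
    | zero => intro i hi; omega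
    | succ m ih =>
      intro i hi
      rcases Nat.lt_succ_iff_lt_or_eq.1 hi with hi | rfl
      · exact ih i hi
      · by_cases hin : i < n
        · exact h.congr le_rfl (fun j hj => (hE j hj).symm) (fun j hj => (ht j hj).symm) i hin
        · refine ⟨NNReal.coe_nonneg _, ?_⟩
          have hp : pick i (g i) = F (g i) := if_neg hin
          have := hF _ (ih.isState hs le_rfl)
          simp only [hg, E', t', hp, Real.toNNReal_coe] at this ⊢
          exact this
  obtain ⟨ρ, h1, h2⟩ := exists_run_of_firesAlong hf
  exact ⟨ρ, fun i hi => by rw [h1, hE i hi], fun i hi => by rw [h2, ht i hi]⟩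

variable (A) in
/-- The runs whose first `n` edges are those of `E`, with delays in `C`. -/
def cylinder (s : L × Val X) (n : ℕ) (E : ℕ → TAEdge L X) (C : Set (Fin n → ℝ)) :
    Set (A.Run s) :=
  {ρ | (∀ i < n, ρ.edge i = E i) ∧ initSeg n ρ.delays ∈ C}

theorem cyl_eq (s : L × Val X) (n : ℕ) (E : ℕ → TAEdge L X) (C : Set (Fin n → ℝ)) :
    A.Cyl s (fun i : Fin n => E i) C = A.cylinder s n E C := by
  ext ρ
  exact and_congr ⟨fun h i hi => h ⟨i, hi⟩, fun h i => h i i.2⟩ Iff.rfl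

theorem firesAlong_of_mem_cylinder {s : L × Val X} {n : ℕ} {E : ℕ → TAEdge L X}
    {C : Set (Fin n → ℝ)} {ρ : A.Run s} (h : ρ ∈ A.cylinder s n E C) :
    A.FiresAlong s E ρ.delays n := (ρ.firesAlong n).congr le_rfl h.1 fun _ _ => rfl

theorem mem_basicOpens_cylinder {s : L × Val X} {n : ℕ} {E : ℕ → TAEdge L X}
    {C O : Set (Fin n → ℝ)} (hC : MeasurableSet C) (hO : IsOpen O)
    (hCO : C ∩ A.delayPoly s E n = O ∩ A.delayPoly s E n)
    (hne : (C ∩ A.delayPoly s E n).Nonempty) (h : A.ThickSet s E (C ∩ A.delayPoly s E n)) :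
    A.cylinder s n E C ∈ A.basicOpens s := by
  refine Or.inr (Or.inr ⟨n, fun i => E i, C, (thickPath_iff hne).2 h, hC, ⟨O, hO, ?_⟩,
    (cyl_eq _ _ _ _).symm⟩)
  rw [pol_eq, pol_eq, hCO, Set.univ_inter]

/-- A basic open set containing a run is the whole space or a thick cylinder along that run. -/
theorem eq_univ_or_of_mem_basicOpens {s : L × Val X} {U : Set (A.Run s)} (hU : U ∈ A.basicOpens s)
    {ρ : A.Run s} (hρ : ρ ∈ U) :
    U = Set.univ ∨ ∃ (n : ℕ) (C O : Set (Fin n → ℝ)), MeasurableSet C ∧ IsOpen O ∧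
      C ∩ A.delayPoly s ρ.edge n = O ∩ A.delayPoly s ρ.edge n ∧
      A.ThickSet s ρ.edge (C ∩ A.delayPoly s ρ.edge n) ∧ U = A.cylinder s n ρ.edge C := by
  rcases hU with rfl | rfl | ⟨n, es, C, h1, h2, ⟨O, h3, h4⟩, rfl⟩
  · exact Or.inl rfl
  · exact absurd hρ (Set.notMem_empty ρ)
  · right
    obtain rfl : (fun i : Fin n => ρ.edge i) = es := funext fun i => hρ.1 i
    rw [cyl_eq] at hρ ⊢
    rw [pol_eq, pol_eq, Set.univ_inter] at h4
    exact ⟨n, C, O, h2, h3, h4,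
      (thickPath_iff ⟨_, hρ.2, mem_delayPoly_initSeg.2 (firesAlong_of_mem_cylinder hρ)⟩).1 h1, rfl⟩

/-- Both cylinders contain ρ, hence follow its edges, and the shorter constraint can be pulled back
to length m. The intersection contains a relative ball around the delays of ρ, so it is thick by
`ThickSet.mono`. -/
theorem exists_mem_basicOpens_subset_inter_cylinder {s : L × Val X} {ρ : A.Run s} {n m : ℕ}
    (hnm : n ≤ m) {C O : Set (Fin n → ℝ)} {C' O' : Set (Fin m → ℝ)} (hC : MeasurableSet C)
    (hO : IsOpen O) (hCO : C ∩ A.delayPoly s ρ.edge n = O ∩ A.delayPoly s ρ.edge n)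
    (hC' : MeasurableSet C') (hO' : IsOpen O')
    (hCO' : C' ∩ A.delayPoly s ρ.edge m = O' ∩ A.delayPoly s ρ.edge m)
    (h : A.ThickSet s ρ.edge (C' ∩ A.delayPoly s ρ.edge m))
    (hρ : ρ ∈ A.cylinder s n ρ.edge C) (hρ' : ρ ∈ A.cylinder s m ρ.edge C') :
    ∃ U ∈ A.basicOpens s, ρ ∈ U ∧ U ⊆ A.cylinder s n ρ.edge C ∩ A.cylinder s m ρ.edge C' := by
  have hc : Continuous (restr n : (Fin m → ℝ) → Fin n → ℝ) := (lipschitzWith_restr m n).continuous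
  have hCO₂ : (C' ∩ restr n ⁻¹' C) ∩ A.delayPoly s ρ.edge m =
      (O' ∩ restr n ⁻¹' O) ∩ A.delayPoly s ρ.edge m := by
    ext u
    have h1 := Set.ext_iff.1 hCO (restr n u)
    have h2 := Set.ext_iff.1 hCO' u
    have h3 : u ∈ A.delayPoly s ρ.edge m → restr n u ∈ A.delayPoly s ρ.edge n :=
      fun hu => restr_mem_delayPoly hu hnm
    simp only [Set.mem_inter_iff, Set.mem_preimage] at h1 h2 ⊢
    tauto
  have hmem : initSeg m ρ.delays ∈ (C' ∩ restr n ⁻¹' C) ∩ A.delayPoly s ρ.edge m := by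
    refine ⟨⟨hρ'.2, ?_⟩, mem_delayPoly_initSeg.2 (ρ.firesAlong m)⟩
    rw [Set.mem_preimage, restr_initSeg _ hnm]
    exact hρ.2
  have hO₂ : IsOpen (O' ∩ restr n ⁻¹' O) := hO'.inter (hO.preimage hc)
  refine ⟨A.cylinder s m ρ.edge (C' ∩ restr n ⁻¹' C), mem_basicOpens_cylinder
    (hC'.inter (hc.measurable hC)) hO₂ hCO₂ ⟨_, hmem⟩ ?_, ⟨fun _ _ => rfl, hmem.1⟩, ?_⟩
  · have hmemO := hmem
    rw [hCO₂] at hmemO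
    obtain ⟨r, hr, hb⟩ := Metric.isOpen_iff.1 hO₂ _ hmemO.1
    refine h.mono Set.inter_subset_right (Set.inter_subset_inter_left _ Set.inter_subset_left)
      hmem.2 hr ?_
    rw [hCO₂]
    exact Set.inter_subset_inter_left _ hb
  · rintro ρ' ⟨h1, h2, h3⟩
    rw [Set.mem_preimage, restr_initSeg _ hnm] at h3
    exact ⟨⟨fun i hi => h1 i (hi.trans_le hnm), h3⟩, h1, h2⟩

theorem isTopologicalBasis_basicOpens (s : L × Val X) :
    TopologicalSpace.IsTopologicalBasis (A.basicOpens s) where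
  exists_subset_inter := by
    intro U hU V hV ρ hρ
    rcases eq_univ_or_of_mem_basicOpens hU hρ.1 with rfl | ⟨n, C, O, h1, h2, h3, h4, rfl⟩
    · exact ⟨V, hV, hρ.2, by simp⟩
    rcases eq_univ_or_of_mem_basicOpens hV hρ.2 with rfl | ⟨m, C', O', h1', h2', h3', h4', rfl⟩
    · exact ⟨_, hU, hρ.1, by simp⟩
    rcases le_total n m with hnm | hnm
    · exact exists_mem_basicOpens_subset_inter_cylinder hnm h1 h2 h3 h1' h2' h3' h4' hρ.1 hρ.2
    · rw [Set.inter_comm]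
      exact exists_mem_basicOpens_subset_inter_cylinder hnm h1' h2' h3' h1 h2 h3 h4 hρ.2 hρ.1
  sUnion_eq := Set.eq_univ_of_univ_subset (Set.subset_sUnion_of_mem (Or.inl rfl))
  eq_generateFrom := rfl

theorem cylinder_subset {s : L × Val X} {n n' : ℕ} {E E' : ℕ → TAEdge L X} {x x' : ℕ → ℝ}
    {r r' : ℝ} (hn : n ≤ n') (hE : ∀ i < n, E' i = E i) (hx : ∀ i < n, x' i = x i) (hr : r' ≤ r) :
    A.cylinder s n' E' (Metric.ball (initSeg n' x') r') ⊆
      A.cylinder s n E (Metric.ball (initSeg n x) r) := by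
  rintro ρ ⟨h1, h2⟩
  refine ⟨fun i hi => (h1 i (hi.trans_le hn)).trans (hE i hi), ?_⟩
  have hxx : initSeg n x' = initSeg n x := funext fun i => hx i i.2
  rw [← hxx, ← restr_initSeg ρ.delays hn, ← restr_initSeg x' hn]
  exact (dist_restr_le _ _).trans_lt (h2.trans_le hr)

theorem reg_state_of_mem_cylinder [Fintype L] {s : L × Val X} {n : ℕ} {E : ℕ → TAEdge L X}
    {x : ℕ → ℝ} {r : ℝ} (h : A.IsThickCylinder s n E x r) {ρ : A.Run s}
    (hρ : ρ ∈ A.cylinder s n E (Metric.ball (initSeg n x) r)) {i : ℕ} (hi : i ≤ n) :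
    A.reg (ρ.state i) = A.reg (stateAlong s E x i) := by
  rw [← h.reg_eq _ ⟨hρ.2, mem_delayPoly_initSeg.2 (firesAlong_of_mem_cylinder hρ)⟩ i hi, ρ.state_eq]
  exact congrArg _ (stateAlong_congr (fun j hj => hρ.1 j (hj.trans_le hi))
    fun j hj => (extZero_initSeg _ (hj.trans_le hi)).symm)

namespace IsThickCylinder

variable [Fintype L] {s : L × Val X} {n : ℕ} {E : ℕ → TAEdge L X} {x : ℕ → ℝ} {r : ℝ}

theorem isOpen (h : A.IsThickCylinder s n E x r) :
    IsOpen (A.cylinder s n E (Metric.ball (initSeg n x) r)) :=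
  (isTopologicalBasis_basicOpens s).isOpen (mem_basicOpens_cylinder measurableSet_ball
    Metric.isOpen_ball rfl ⟨_, Metric.mem_ball_self h.pos, h.mem_delayPoly⟩ h.thick)

theorem nonempty (h : A.IsThickCylinder s n E x r) (hA : A.NonBlocking) (hs : A.IsState s) :
    (A.cylinder s n E (Metric.ball (initSeg n x) r)).Nonempty := by
  obtain ⟨ρ, h1, h2⟩ := hA.exists_run hs h.fires
  have : initSeg n ρ.delays = initSeg n x := funext fun i => h2 i i.2
  exact ⟨ρ, h1, by rw [this]; exact Metric.mem_ball_self h.pos⟩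

theorem exists_succ [Finite X] (h : A.IsThickCylinder s n E x r) {q : L × A.Region}
    (hq : A.ThickGraph (A.reg (stateAlong s E x n)) q) :
    ∃ E' x' r', A.IsThickCylinder s (n + 1) E' x' r' ∧ A.reg (stateAlong s E' x' (n + 1)) = q ∧
      A.cylinder s (n + 1) E' (Metric.ball (initSeg (n + 1) x') r') ⊆
        A.cylinder s n E (Metric.ball (initSeg n x) r) := by
  obtain ⟨τ, e, h1, rfl⟩ := exists_thickStep_of_thickGraph hq
  obtain ⟨r', hr', h2⟩ := h.extend h1
  refine ⟨_, _, r', h2, ?_, cylinder_subset (Nat.le_succ n)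
    (fun i hi => Function.update_of_ne hi.ne _ _) (fun i hi => Function.update_of_ne hi.ne _ _) hr'⟩
  rw [stateAlong, Function.update_self, Function.update_self, Real.toNNReal_coe,
    stateAlong_congr (fun i hi => Function.update_of_ne hi.ne _ _)
      fun i hi => Function.update_of_ne hi.ne _ _]

/-- Inside any thick cylinder the runs can be steered to any vertex reachable from its last one. -/
theorem exists_of_reflTransGen [Finite X] (h : A.IsThickCylinder s n E x r) {q : L × A.Region}
    (hq : Relation.ReflTransGen A.ThickGraph (A.reg (stateAlong s E x n)) q) :
    ∃ n' ≥ n, ∃ E' x' r', A.IsThickCylinder s n' E' x' r' ∧ A.reg (stateAlong s E' x' n') = q ∧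
      A.cylinder s n' E' (Metric.ball (initSeg n' x') r') ⊆
        A.cylinder s n E (Metric.ball (initSeg n x) r) := by
  induction hq with
  | refl => exact ⟨n, le_rfl, E, x, r, h, rfl, subset_rfl⟩
  | tail _ hq ih =>
    obtain ⟨n', hn', E', x', r', h1, rfl, h2⟩ := ih
    obtain ⟨E₂, x₂, r₂, h3, h4, h5⟩ := h1.exists_succ hq
    exact ⟨n' + 1, by omega, E₂, x₂, r₂, h3, h4, h5.trans h2⟩

theorem exists_le_length [Finite X] (h : A.IsThickCylinder s n E x r) (hA : A.NonBlocking)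
    (hs : A.IsState s) (m : ℕ) :
    ∃ n' ≥ m, ∃ E' x' r', A.IsThickCylinder s n' E' x' r' ∧
      A.cylinder s n' E' (Metric.ball (initSeg n' x') r') ⊆
        A.cylinder s n E (Metric.ball (initSeg n x) r) := by
  induction m with
  | zero => exact ⟨n, Nat.zero_le _, E, x, r, h, subset_rfl⟩
  | succ m ih =>
    obtain ⟨n', hn', E', x', r', h1, h2⟩ := ih
    obtain ⟨τ, e, h3⟩ := hA.exists_thickStep (h1.fires.isState hs le_rfl)
    obtain ⟨E₂, x₂, r₂, h4, -, h5⟩ := h1.exists_succ h3.thickGraph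
    exact ⟨n' + 1, by omega, E₂, x₂, r₂, h4, h5.trans h2⟩

end IsThickCylinder

/-- With this, density and residuality need testing on thick cylinders only. The ball need not lie
in the constraint C, but C and O agree on the polyhedron, where the delays of runs lie. -/
theorem exists_isThickCylinder_subset [Fintype L] [Finite X] {s : L × Val X} {W : Set (A.Run s)}
    (hW : IsOpen W) (hne : W.Nonempty) :
    ∃ n E x r, A.IsThickCylinder s n E x r ∧
      A.cylinder s n E (Metric.ball (initSeg n x) r) ⊆ W := by
  obtain ⟨ρ, hρ⟩ := hne
  obtain ⟨U, hU, hρU, hUW⟩ := (isTopologicalBasis_basicOpens s).exists_subset_of_mem_open hρ hW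
  rcases eq_univ_or_of_mem_basicOpens hU hρU with rfl | ⟨n, C, O, -, h2, h3, h4, rfl⟩
  · exact ⟨0, ρ.edge, 0, 1, .zero s _ _, (Set.subset_univ _).trans hUW⟩
  · rw [h3] at h4
    have hne : (O ∩ A.delayPoly s ρ.edge n).Nonempty := by
      rw [← h3]
      exact ⟨_, hρU.2, mem_delayPoly_initSeg.2 (ρ.firesAlong n)⟩
    obtain ⟨x, r, h5, h6⟩ := h4.exists_isThickCylinder h2 hne
    refine ⟨n, ρ.edge, x, r, h5, fun ρ' hρ' => hUW ⟨hρ'.1, ?_⟩⟩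
    have : initSeg n ρ'.delays ∈ O ∩ A.delayPoly s ρ.edge n :=
      ⟨h6 hρ'.2, mem_delayPoly_initSeg.2 (firesAlong_of_mem_cylinder hρ')⟩
    rw [← h3] at this
    exact this.1

/-- For S = U ∩ F, closed balls inside U see only the closed set F. Applied to delay polyhedra, this
keeps limits of feasible delays feasible. -/
theorem _root_.IsLocallyClosed.exists_isClosed_closedBall_inter {Z : Type*} [PseudoMetricSpace Z]
    {S : Set Z} (hS : IsLocallyClosed S) {z : Z} (hz : z ∈ S) :
    ∃ r > 0, ∀ r' ≤ r, IsClosed (Metric.closedBall z r' ∩ S) := by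
  obtain ⟨U, F, hU, hF, rfl⟩ := hS
  obtain ⟨r, hr, hb⟩ := Metric.nhds_basis_closedBall.mem_iff.1 (hU.mem_nhds hz.1)
  refine ⟨r, hr, fun r' hr' => ?_⟩
  rw [← Set.inter_assoc, Set.inter_eq_left.2 ((Metric.closedBall_subset_closedBall hr').trans hb)]
  exact Metric.isClosed_closedBall.inter hF

/-- Every non-empty open set contains a long and small closed thick cylinder. -/
theorem exists_isThickCylinder_closedBall_subset [Fintype L] [Finite X] (hA : A.NonBlocking)
    {s : L × Val X} (hs : A.IsState s) {W : Set (A.Run s)} (hW : IsOpen W) (hne : W.Nonempty)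
    (m : ℕ) {ε : ℝ} (hε : 0 < ε) :
    ∃ n E x r, A.IsThickCylinder s n E x r ∧ m ≤ n ∧ r ≤ ε ∧
      IsClosed (Metric.closedBall (initSeg n x) r ∩ A.delayPoly s E n) ∧
      A.cylinder s n E (Metric.closedBall (initSeg n x) r) ⊆ W := by
  obtain ⟨n₀, E₀, x₀, r₀, h₀, hsub₀⟩ := exists_isThickCylinder_subset hW hne
  obtain ⟨n, hn, E, x, r, h, hsub⟩ := h₀.exists_le_length hA hs m
  obtain ⟨δ, hδ, hcl⟩ :=
    (isLocallyClosed_delayPoly s E n).exists_isClosed_closedBall_inter h.mem_delayPoly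
  have hr := h.pos
  set r' := min (r / 2) (min ε δ)
  have hr' : 0 < r' := lt_min (by linarith) (lt_min hε hδ)
  have hr2 : r' ≤ r / 2 := min_le_left _ _
  refine ⟨n, E, x, r', h.mono hr' (by linarith), hn, (min_le_right _ _).trans (min_le_left _ _),
    hcl _ ((min_le_right _ _).trans (min_le_right _ _)), ?_⟩
  refine subset_trans (fun ρ hρ => ?_) (hsub.trans hsub₀)
  exact ⟨hρ.1, Metric.closedBall_subset_ball (by linarith) hρ.2⟩

end TimedAutomaton

/-! ### The Baire property and generic runs -/

namespace TimedAutomaton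

variable {L X AP : Type*} {A : TimedAutomaton L X AP}

open Filter Topology in
/-- The limit of a shrinking sequence of closed cylinders. -/
theorem exists_run_mem_iInter_cylinder {s : L × Val X} {n : ℕ → ℕ} {E : ℕ → ℕ → TAEdge L X}
    {x : ℕ → ℕ → ℝ} {r : ℕ → ℝ} (hn : ∀ k, k ≤ n k) (hr : Tendsto r atTop (𝓝 0))
    (hcl : ∀ k, IsClosed
      (Metric.closedBall (initSeg (n k) (x k)) (r k) ∩ A.delayPoly s (E k) (n k)))
    (hne : ∀ k, (A.cylinder s (n k) (E k) (Metric.closedBall (initSeg (n k) (x k)) (r k))).Nonempty)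
    (hsub : ∀ k, A.cylinder s (n (k + 1)) (E (k + 1))
        (Metric.closedBall (initSeg (n (k + 1)) (x (k + 1))) (r (k + 1))) ⊆
      A.cylinder s (n k) (E k) (Metric.closedBall (initSeg (n k) (x k)) (r k))) :
    ∃ ρ, ∀ k, ρ ∈ A.cylinder s (n k) (E k) (Metric.closedBall (initSeg (n k) (x k)) (r k)) := by
  have hanti := antitone_nat_of_succ_le (f := fun k =>
    A.cylinder s (n k) (E k) (Metric.closedBall (initSeg (n k) (x k)) (r k))) hsub
  choose ρ hρ using hne
  have hmem : ∀ k l, k ≤ l →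
      ρ l ∈ A.cylinder s (n k) (E k) (Metric.closedBall (initSeg (n k) (x k)) (r k)) :=
    fun k l hkl => hanti hkl (hρ l)
  have hdist : ∀ k l, k ≤ l → ∀ j < n k, dist ((ρ l).delays j) (x k j) ≤ r k := fun k l hkl j hj =>
    (dist_le_pi_dist (initSeg (n k) (ρ l).delays) (initSeg (n k) (x k)) ⟨j, hj⟩).trans
      (hmem k l hkl).2
  have hlim : ∀ j, ∃ t, Tendsto (fun k => (ρ k).delays j) atTop (𝓝 t) := by
    intro j
    -- After the shift by j + 1 every cylinder has length greater than j, so it controls the j-th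
    -- delay.
    have hc : CauchySeq fun k => (ρ (k + (j + 1))).delays j := by
      refine cauchySeq_of_le_tendsto_0' (fun k => r (k + (j + 1)) + r (k + (j + 1)))
        (fun k l hkl => ?_) ?_
      · have hj : j < n (k + (j + 1)) := lt_of_lt_of_le (by omega) (hn _)
        exact (dist_triangle_right _ _ (x (k + (j + 1)) j)).trans
          (add_le_add (hdist _ _ le_rfl j hj) (hdist _ _ (by omega) j hj))
      · have := (tendsto_add_atTop_iff_nat (j + 1)).2 hr
        simpa using this.add this
    obtain ⟨t, ht⟩ := cauchySeq_tendsto_of_complete hc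
    exact ⟨t, (tendsto_add_atTop_iff_nat (f := fun k => (ρ k).delays j) (j + 1)).1 ht⟩
  choose t ht using hlim
  -- All runs from the (j+1)-st on share their j-th edge, since that cylinder has length at least j
  -- + 1.
  let F : ℕ → TAEdge L X := fun j => (ρ (j + 1)).edge j
  have hF : ∀ k, ∀ j < n k, F j = E k j := by
    intro k j hj
    have h1 := (hmem k (max k (j + 1)) (le_max_left _ _)).1 j hj
    have h2 := (hmem (j + 1) (max k (j + 1)) (le_max_right _ _)).1 j (hn (j + 1))
    have h3 := (hmem (j + 1) (j + 1) le_rfl).1 j (hn (j + 1))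
    exact h3.trans (h2.symm.trans h1)
  have hpoly : ∀ k, initSeg (n k) t ∈
      Metric.closedBall (initSeg (n k) (x k)) (r k) ∩ A.delayPoly s (E k) (n k) := by
    intro k
    have hconv : Tendsto (fun l => initSeg (n k) (ρ l).delays) atTop (𝓝 (initSeg (n k) t)) :=
      tendsto_pi_nhds.2 fun j => ht j
    refine (hcl k).mem_of_tendsto hconv ?_
    filter_upwards [eventually_ge_atTop k] with l hl
    exact ⟨(hmem k l hl).2, mem_delayPoly_initSeg.2 (firesAlong_of_mem_cylinder (hmem k l hl))⟩
  have hfires : ∀ k, A.FiresAlong s F t k := fun k =>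
    (mem_delayPoly_initSeg.1 (hpoly k).2).congr (hn k)
      (fun j hj => (hF k j (hj.trans_le (hn k))).symm) fun _ _ => rfl
  obtain ⟨σ, h1, h2⟩ := exists_run_of_firesAlong hfires
  exact ⟨σ, fun k => ⟨fun j hj => by rw [h1, hF k j hj], by rw [h2]; exact (hpoly k).1⟩⟩

variable [Fintype L]

open Filter Topology in
-- Cantor's argument with cylinders in place of balls: the k-th cylinder has length at least k,
-- radius at most 1/(k+1) and a closed set of delays, and its successor lies in it and in the k-th
-- dense open set. Non-blockingness makes each cylinder non-empty.
theorem NonBlocking.baireSpace_run [Finite X] (hA : A.NonBlocking) {s : L × Val X}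
    (hs : A.IsState s) : BaireSpace (A.Run s) := by
  refine ⟨fun f hfo hfd => dense_iff_inter_open.2 fun W hW hWne => ?_⟩
  let Cyl := Σ n : ℕ, (ℕ → TAEdge L X) × (ℕ → ℝ) × ℝ
  let op : Cyl → Set (A.Run s) := fun p =>
    A.cylinder s p.1 p.2.1 (Metric.ball (initSeg p.1 p.2.2.1) p.2.2.2)
  let clo : Cyl → Set (A.Run s) := fun p =>
    A.cylinder s p.1 p.2.1 (Metric.closedBall (initSeg p.1 p.2.2.1) p.2.2.2)
  let good : ℕ → Cyl → Prop := fun k p => A.IsThickCylinder s p.1 p.2.1 p.2.2.1 p.2.2.2 ∧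
    k ≤ p.1 ∧ p.2.2.2 ≤ 1 / ((k : ℝ) + 1) ∧
    IsClosed (Metric.closedBall (initSeg p.1 p.2.2.1) p.2.2.2 ∩ A.delayPoly s p.2.1 p.1)
  have hstep : ∀ (k : ℕ) (V : Set (A.Run s)), IsOpen V → V.Nonempty →
      ∃ p, good k p ∧ clo p ⊆ V := by
    intro k V hV hVne
    obtain ⟨n, E, x, r, h1, h2, h3, h4, h5⟩ := exists_isThickCylinder_closedBall_subset hA hs hV
      hVne k (ε := 1 / ((k : ℝ) + 1)) (by positivity)
    exact ⟨⟨n, E, x, r⟩, ⟨h1, h2, h3, h4⟩, h5⟩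
  have hnext : ∀ (k : ℕ) (p : {p : Cyl // good k p}),
      ∃ p' : {p : Cyl // good (k + 1) p}, clo p'.1 ⊆ op p.1 ∩ f k := by
    rintro k ⟨p, hp⟩
    obtain ⟨p', h1, h2⟩ := hstep (k + 1) (op p ∩ f k) (hp.1.isOpen.inter (hfo k))
      ((hfd k).inter_open_nonempty _ hp.1.isOpen (hp.1.nonempty hA hs))
    exact ⟨⟨p', h1⟩, h2⟩
  choose nxt hnxt using hnext
  obtain ⟨p₀, hp₀, hp₀W⟩ := hstep 0 W hW hWne
  let p : (k : ℕ) → {p : Cyl // good k p} := fun k => Nat.rec ⟨p₀, hp₀⟩ (fun k q => nxt k q) k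
  have hp : ∀ k, clo (p (k + 1)).1 ⊆ op (p k).1 ∩ f k := fun k => hnxt k (p k)
  have hopclo : ∀ q, op q ⊆ clo q := fun q ρ hρ => ⟨hρ.1, Metric.ball_subset_closedBall hρ.2⟩
  obtain ⟨ρ, hρ⟩ := exists_run_mem_iInter_cylinder (A := A) (s := s)
    (n := fun k => (p k).1.1) (E := fun k => (p k).1.2.1) (x := fun k => (p k).1.2.2.1)
    (r := fun k => (p k).1.2.2.2) (fun k => (p k).2.2.1)
    (squeeze_zero (fun k => (p k).2.1.pos.le) (fun k => (p k).2.2.2.1)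
      tendsto_one_div_add_atTop_nhds_zero_nat)
    (fun k => (p k).2.2.2.2) (fun k => ((p k).2.1.nonempty hA hs).mono (hopclo _))
    (fun k => ((hp k).trans Set.inter_subset_left).trans (hopclo _))
  exact ⟨ρ, hp₀W (hρ 0), Set.mem_iInter.2 fun k => (hp k (hρ (k + 1))).2⟩

/-- A set of runs that contains a subcylinder of every thick cylinder is residual. -/
theorem mem_residual_of_forall_isThickCylinder [Finite X] (hA : A.NonBlocking) {s : L × Val X}
    (hs : A.IsState s) {S : Set (A.Run s)}
    (h : ∀ n E x r, A.IsThickCylinder s n E x r → ∃ n' E' x' r', A.IsThickCylinder s n' E' x' r' ∧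
      A.cylinder s n' E' (Metric.ball (initSeg n' x') r') ⊆
        A.cylinder s n E (Metric.ball (initSeg n x) r) ∩ S) : S ∈ residual (A.Run s) := by
  refine Filter.mem_of_superset (residual_of_dense_open isOpen_interior ?_) interior_subset
  refine dense_iff_inter_open.2 fun W hW hWne => ?_
  obtain ⟨n, E, x, r, h1, h2⟩ := exists_isThickCylinder_subset hW hWne
  obtain ⟨n', E', x', r', h3, h4⟩ := h n E x r h1
  obtain ⟨ρ, hρ⟩ := h3.nonempty hA hs
  exact ⟨ρ, h2 (h4 hρ).1, mem_interior.2 ⟨_, h4.trans Set.inter_subset_right, h3.isOpen, hρ⟩⟩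

/-- Generic runs follow the thick graph. -/
theorem eventually_residual_thickGraph [Finite X] (hA : A.NonBlocking) {s : L × Val X}
    (hs : A.IsState s) :
    ∀ᶠ ρ : A.Run s in residual (A.Run s),
      ∀ i, A.ThickGraph (A.reg (ρ.state i)) (A.reg (ρ.state (i + 1))) := by
  refine eventually_countable_forall.2 fun i =>
    mem_residual_of_forall_isThickCylinder hA hs fun n E x r h => ?_
  obtain ⟨n', hn', E', x', r', h1, h2⟩ := h.exists_le_length hA hs (i + 1)
  refine ⟨n', E', x', r', h1, fun ρ hρ => ⟨h2 hρ, ?_⟩⟩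
  rw [Set.mem_ofPred_eq, reg_state_of_mem_cylinder h1 hρ (by omega), reg_state_of_mem_cylinder h1 hρ hn']
  exact h1.graph i hn'

/-- Generic runs visit infinitely often all the vertices that always remain reachable. -/
theorem eventually_residual_visits [Finite X] (hA : A.NonBlocking) {s : L × Val X}
    (hs : A.IsState s) :
    ∀ᶠ ρ : A.Run s in residual (A.Run s), ∀ (q : L × A.Region) (m : ℕ),
      (∃ i ≥ m, A.reg (ρ.state i) = q) ∨
        ∃ i, ¬ Relation.ReflTransGen A.ThickGraph (A.reg (ρ.state i)) q := by
  have : Countable (L × A.Region) := Finite.to_countable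
  refine eventually_countable_forall.2 fun q => eventually_countable_forall.2 fun m =>
    mem_residual_of_forall_isThickCylinder hA hs fun n E x r h => ?_
  obtain ⟨n', hn', E', x', r', h1, h2⟩ := h.exists_le_length hA hs m
  -- All runs of the cylinder are at the same vertex at time n' ≥ m. Either q is reachable from it
  -- and the runs are steered there, or the second alternative holds for all of them.
  by_cases hq : Relation.ReflTransGen A.ThickGraph (A.reg (stateAlong s E' x' n')) q
  · obtain ⟨n₂, hn₂, E₂, x₂, r₂, h3, h4, h5⟩ := h1.exists_of_reflTransGen hq
    refine ⟨n₂, E₂, x₂, r₂, h3, fun ρ hρ => ⟨h2 (h5 hρ), Or.inl ⟨n₂, by omega, ?_⟩⟩⟩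
    rw [reg_state_of_mem_cylinder h3 hρ le_rfl, h4]
  · refine ⟨n', E', x', r', h1, fun ρ hρ => ⟨h2 hρ, Or.inr ⟨n', ?_⟩⟩⟩
    rwa [reg_state_of_mem_cylinder h1 hρ le_rfl]

end TimedAutomaton

/-! ### Paths and bottom components of finite graphs -/

section Graph

variable {Q : Type*} {G : Q → Q → Prop}

theorem reflTransGen_of_path {π : ℕ → Q} (h : ∀ i, G (π i) (π (i + 1))) {i j : ℕ} (hij : i ≤ j) :
    Relation.ReflTransGen G (π i) (π j) := by
  induction j, hij using Nat.le_induction with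
  | base => exact .refl
  | succ j _ ih => exact ih.tail (h j)

theorem IsBSCC.mem_of_reflTransGen {C : Set Q} (hC : IsBSCC G C) {q q' : Q} (hq : q ∈ C)
    (h : Relation.ReflTransGen G q q') : q' ∈ C := by
  induction h with
  | refl => exact hq
  | tail _ h ih => exact hC.2.2 _ ih _ h

/-- A path that visits infinitely often all the vertices that always remain reachable ends up in a
bottom strongly connected component. -/
theorem isBSCC_setOf_forall_reflTransGen [Finite Q] {π : ℕ → Q} (h : ∀ i, G (π i) (π (i + 1)))
    (hv : ∀ (q : Q) (m : ℕ), (∃ i ≥ m, π i = q) ∨ ∃ i, ¬ Relation.ReflTransGen G (π i) q) :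
    IsBSCC G {q | ∀ i, Relation.ReflTransGen G (π i) q} := by
  refine ⟨?_, fun q hq q' hq' => ?_, fun q hq q' hqq' i => (hq i).tail hqq'⟩
  -- By finiteness some vertex recurs for ever, and it is reachable from every position of the path.
  · obtain ⟨q, hq⟩ := Finite.exists_infinite_fiber π
    rw [Set.infinite_coe_iff] at hq
    refine ⟨q, fun i => ?_⟩
    obtain ⟨j, hj, hij⟩ := hq.exists_gt i
    have := reflTransGen_of_path h hij.le
    rwa [show π j = q from hj] at this
  -- A vertex that always remains reachable is visited, and from the position of that visit q' is
  -- still reachable.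
  · rcases hv q 0 with ⟨i, -, rfl⟩ | ⟨i, hi⟩
    · exact hq' i
    · exact absurd (hq i) hi

theorem infLetters_eq_image {B : Type*} {π : ℕ → Q} {C : Set Q} (f : Q → B)
    (hev : ∀ᶠ i in Filter.atTop, π i ∈ C) (hC : ∀ q ∈ C, ∃ᶠ i in Filter.atTop, π i = q) :
    infLetters (fun i => f (π i)) = f '' C := by
  ext b
  constructor
  · intro hb
    obtain ⟨i, h1, h2⟩ := (Filter.Frequently.and_eventually hb hev).exists
    exact ⟨π i, h2, h1⟩
  · rintro ⟨q, hq, rfl⟩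
    exact (hC q hq).mono fun i hi => congrArg f hi

theorem IsBSCC.eventually_mem {C : Set Q} (hC : IsBSCC G C) {π : ℕ → Q}
    (h : ∀ i, G (π i) (π (i + 1))) {n : ℕ} (hn : π n ∈ C) :
    ∀ᶠ i in Filter.atTop, π i ∈ C := by
  filter_upwards [Filter.eventually_ge_atTop n] with i hi
  exact hC.mem_of_reflTransGen hn (reflTransGen_of_path h hi)

end Graph

/-! ### The main theorem -/

theorem mainTheorem4 {L X AP : Type*} [Fintype L] [Finite X] [Finite AP]
    (A : TimedAutomaton L X AP) (hA : A.NonBlocking)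
    (s : L × Val X) (hs : A.IsState s)
    (P : Set (ℕ → Set AP)) (hP : PrefixIndependent P) :
    A.LargelySatisfies s P ↔ A.ConditionS s P := by
  have hgen := (TimedAutomaton.eventually_residual_thickGraph hA hs).and
    (TimedAutomaton.eventually_residual_visits hA hs)
  rw [TimedAutomaton.LargelySatisfies, IsMeagre, compl_compl]
  constructor
  · intro hlarge C hC ⟨q, hqC, hsq⟩ π hπ hπC
    have : BaireSpace (A.Run s) := hA.baireSpace_run hs
    -- Starting from the cylinder of length 0, the runs are steered into C. The edge and delays
    -- given here are placeholders that a cylinder of length 0 never reads.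
    obtain ⟨n, -, E, x, r, hcyl, hreg, -⟩ :=
      (TimedAutomaton.IsThickCylinder.zero (A := A) s (fun _ => ⟨s.1, ∅, ∅, s.1⟩) 0
        ).exists_of_reflTransGen (q := q) hsq
    -- By the Baire property the residual set of generic runs satisfying P is dense, so it meets
    -- this open cylinder.
    obtain ⟨ρ, hρ, hρP, hthick, hvis⟩ := (dense_of_mem_residual
      (Filter.inter_mem hlarge hgen)).inter_open_nonempty _ hcyl.isOpen (hcyl.nonempty hA hs)
    have hn : A.reg (ρ.state n) ∈ C := by
      rwa [TimedAutomaton.reg_state_of_mem_cylinder hcyl hρ le_rfl, hreg]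
    have hρC : ∀ q' ∈ C, ∃ᶠ i in Filter.atTop, A.reg (ρ.state i) = q' := fun q' hq' =>
      Filter.frequently_atTop.2 fun m => (hvis q' m).resolve_right fun ⟨i, hi⟩ => hi
        ((reflTransGen_of_path (π := fun i => A.reg (ρ.state i)) hthick (le_max_left i n)).trans
          (hC.2.1 _ (hC.mem_of_reflTransGen hn
            (reflTransGen_of_path (π := fun i => A.reg (ρ.state i)) hthick
              (le_max_right i n))) _ hq'))
    -- The path π visits q, so it too stays in C from then on, and both label sequences have the
    -- labels of C as recurrent letters.
    obtain ⟨k, hk⟩ := (hπC q hqC).exists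
    have h1 := infLetters_eq_image (fun q : L × A.Region => A.label q.1)
      (hC.eventually_mem hthick hn) hρC
    have h2 := infLetters_eq_image (fun q : L × A.Region => A.label q.1)
      (hC.eventually_mem hπ (n := k) (by rwa [hk])) hπC
    exact (hP _ _ (h1.trans h2.symm)).1 hρP
  · intro hS
    filter_upwards [hgen] with ρ hρ
    -- The vertices that remain reachable for ever along ρ form a bottom component. The region path
    -- of ρ is itself a path visiting all of it infinitely often, so the condition applies to it
    -- directly.
    have hC := isBSCC_setOf_forall_reflTransGen hρ.1 hρ.2
    obtain ⟨q, hq⟩ := hC.1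
    refine hS _ hC ⟨q, hq, ?_⟩ (fun i => A.reg (ρ.state i)) hρ.1 fun q' hq' => ?_
    · have := hq 0
      rwa [ρ.start] at this
    · exact Filter.frequently_atTop.2 fun m =>
        (hρ.2 q' m).resolve_right fun ⟨i, hi⟩ => hi (hq' i)
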